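/- Let $\mathcal K\subset\mathbb P^2$ be the complex conic $z_0z_2=z_1^2$, let $\mathcal H=\mathcal K^{\{A,B,C,D,E,F\}}\simeq(\mathbb P^1)^6$ be the variety of all maps $h$ from the six letters to $\mathcal K$, and let $\theta(h)$ be the partition of the set of letters into the fibres of $h$. For a partition $\pi$ of the letters, let $\Delta_\pi\subseteq\mathcal H$ (a polydiagonal, of the type given by the sizes of the parts of $\pi$) be the set of those $h$ that are constant on each part of $\pi$. Let $\mathcal H^\circ$ be $\mathcal H$ minus all $\Delta_\pi$ of type $(3,2,1)$ or $(4,1,1)$, let $Z\subset\mathcal H^\circ$ be the union of all $\Delta_\pi\cap\mathcal H^\circ$ of type $(2,2,2)$, and let $Y\subset\mathcal H^\circ$ be the union of all those of type $(2,2,1,1)$ or $(3,1,1,1)$. Let $\mathbb X'$ be the blow-up of $\mathcal H^\circ$ along $Z$, let $Y'\subset\mathbb X'$ be the proper transform of $Y$, let $\mathbb X$ be the blow-up of $\mathbb X'$ along $Y'$, and let $\beta:\mathbb X\to\mathcal H^\circ$ be the composite of the two blow-ups. Write $X_h=\beta^{-1}(h)$. Let $s=\begin{bmatrix}A&B&C\\F&E&D\end{bmatrix}$,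 and let $q_s$ be the extension to $\mathbb X$ of the rational map $p_s:\mathcal H\dashrightarrow(\mathbb P^2)^*$ which sends $h$ with $h(A),\dots,h(F)$ distinct to its Pascal line, the line that contains the three points $AE\cap BF$, $AD\cap CF$, $BD\cap CE$ (where the letters stand for their images under $h$). That is, $q_s(x)=\ell$ if on some open neighbourhood of $x$ in $\mathbb X$ there is a regular map to $(\mathbb P^2)^*$ which has the value $\ell$ at $x$ and agrees with $p_s\circ\beta$ at all points over which the six points of the conic are distinct. **Proposition.** Let $h\in\mathcal H$ with $\theta(h)=AB\cdot EF\cdot C\cdot D$, say $h(A)=h(B)=M$, $h(E)=h(F)=N$, $h(C)=P$, $h(D)=Q$. Then $X_h\simeq\mathbb P^1$, the map $q_s$ is defined, with exactly one value, at every point of $X_h$, and it restricts to an isomorphism of varieties from $X_h$ onto the pencil of lines through the point $MQ\cap NP$, a closed subvariety of $(\mathbb P^2)^*$. -/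

import Mathlib

open scoped LinearAlgebra.Projectivization

noncomputable section

namespace Pascal

/-! ## Classical varieties in products of complex projective spaces -/

/-- The product over `i : ι` of the projective spaces with `n i` homogeneous coordinates,
i.e. the product of the `ℙ^(n i - 1)` over `ℂ`. -/
abbrev MProj {ι : Type} (n : ι → ℕ) : Type := ∀ i, ℙ ℂ (Fin (n i) → ℂ)

/-- Polynomials in all the homogeneous coordinates of `MProj n`. -/
abbrev Poly {ι : Type} (n : ι → ℕ) : Type := MvPolynomial (Σ i, Fin (n i)) ℂ

variable {ι κ : Type} {n : ι → ℕ}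

/-- `G` is multihomogeneous of multidegree `d`: homogeneous of degree `d i` in the coordinates of
the `i`-th factor. -/
def IsForm (G : Poly n) (d : ι →₀ ℕ) : Prop :=
  G.IsWeightedHomogeneous (fun v => Finsupp.single v.1 1) d

/-- The value of a polynomial at chosen homogeneous coordinates of `x`. For a multihomogeneous
polynomial its vanishing does not depend on that choice. -/
def val (x : MProj n) (G : Poly n) : ℂ := MvPolynomial.eval (fun v => (x v.1).rep v.2) G

/-- The values of a tuple of polynomials at chosen homogeneous coordinates of `x`. -/
def vals {m : ℕ} (G : Fin m → Poly n) (x : MProj n) : Fin m → ℂ := fun j => val x (G j)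

/-- The closure in the Zariski topology of `MProj n`. -/
def zariskiClosure (S : Set (MProj n)) : Set (MProj n) :=
  {x | ∀ (G : Poly n) (d : ι →₀ ℕ), IsForm G d → (∀ y ∈ S, val y G = 0) → val x G = 0}

/-- `W` is a Zariski open subset of `S`. -/
def IsOpenIn (W S : Set (MProj n)) : Prop := W ⊆ S ∧ S ∩ zariskiClosure (S \ W) ⊆ S \ W

/-- `φ` is a regular map on `S` to a projective space: near each point of `S` it is given by
forms of the same multidegree which do not vanish simultaneously. -/
def IsRegular {m : ℕ} (φ : MProj n → ℙ ℂ (Fin m → ℂ)) (S : Set (MProj n)) : Prop :=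
  ∀ x ∈ S, ∃ (d : ι →₀ ℕ) (G : Fin m → Poly n), (∀ j, IsForm (G j) d) ∧ vals G x ≠ 0 ∧
    ∀ y ∈ S, ∀ hy : vals G y ≠ 0, φ y = Projectivization.mk ℂ (vals G y) hy

/-- `φ` is an isomorphism of varieties from `S` onto `T`. -/
def IsIsoOn {m : κ → ℕ} (φ : MProj n → MProj m) (S : Set (MProj n)) (T : Set (MProj m)) : Prop :=
  (∀ k, IsRegular (fun x => φ x k) S) ∧ Set.MapsTo φ S T ∧
    ∃ ψ : MProj m → MProj n,
      (∀ i, IsRegular (fun y => ψ y i) T) ∧ Set.MapsTo ψ T S ∧ Set.InvOn ψ φ S T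

/-! ## Blow-ups -/

/-- The forms `F j`, all of the same multidegree, generate locally on `S` the (radical) ideal sheaf
of the closed subset `Z` of `S`: they vanish on `Z` and, near every `x ∈ S`, every form that
vanishes on `Z` is on `S` a combination of the `F j`, after multiplication by a form `U` that does
not vanish at `x`. -/
def Generates {N : ℕ} (F : Fin N → Poly n) (S Z : Set (MProj n)) : Prop :=
  ∃ d : ι →₀ ℕ, (∀ j, IsForm (F j) d) ∧ (∀ j, ∀ z ∈ Z, val z (F j) = 0) ∧
    ∀ x ∈ S, ∀ (G : Poly n) (e : ι →₀ ℕ), IsForm G e → (∀ z ∈ Z, val z G = 0) →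
      ∃ (U : Poly n) (a : ι →₀ ℕ) (C : Fin N → Poly n) (c : ι →₀ ℕ),
        IsForm U a ∧ val x U ≠ 0 ∧ (∀ j, IsForm (C j) c) ∧ c + d = a + e ∧
        ∀ y ∈ S, val y U * val y G = ∑ j, val y (C j) * val y (F j)

open Classical in
/-- Every ideal of forms vanishing on a set has finitely many generators in the above sense, so
that the blow-ups below exist. -/
theorem exists_generates [Finite ι] (S Z : Set (MProj n)) :
    ∃ (N : ℕ) (F : Fin N → Poly n), Generates F S Z := by
  have := Fintype.ofFinite ι
  let := MvPolynomial.weightedGradedAlgebra (R := ℂ)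
    (fun v : (Σ i, Fin (n i)) => (Finsupp.single v.1 1 : ι →₀ ℕ))
  let A : Set (Poly n) := {G | ∃ e, IsForm G e ∧ ∀ z ∈ Z, val z G = 0}
  obtain ⟨t, htA, ht⟩ := (Submodule.fg_span_iff_fg_span_finset_subset (R := Poly n) A).1
    (IsNoetherian.noetherian _)
  choose! e he using fun (G : Poly n) (hG : G ∈ A) => hG
  let d : ι →₀ ℕ := ∑ g ∈ t, e g
  have hd : ∀ g ∈ t, e g ≤ d := fun g hg =>
    Finset.single_le_sum (f := e) (fun _ _ => by simp) hg
  let mon (j : ∀ i, Fin (n i)) (a : ι →₀ ℕ) : Poly n :=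
    ∏ i, (MvPolynomial.X ⟨i, j i⟩) ^ a i
  have hmon : ∀ j a, IsForm (mon j a) a := by
    intro j a
    have h1 : IsForm (mon j a) (∑ i, a i • (Finsupp.single i 1 : ι →₀ ℕ)) :=
      MvPolynomial.IsWeightedHomogeneous.prod _ _ _ fun i _ =>
        (MvPolynomial.isWeightedHomogeneous_X ℂ _ _).pow _
    have h2 : (∑ i, a i • (Finsupp.single i 1 : ι →₀ ℕ)) = a := by
      ext k
      simp
    rwa [h2] at h1
  have hadd : ∀ j a b, mon j a * mon j b = mon j (a + b) := by
    intro j a b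
    simp [mon, pow_add, Finset.prod_mul_distrib]
  let F' : (t × (∀ i, Fin (n i))) → Poly n := fun p => mon p.2 (d - e p.1) * p.1
  let eq := Fintype.equivFin (t × (∀ i, Fin (n i)))
  refine ⟨_, fun k => F' (eq.symm k), d, fun k => ?_, fun k z hz => ?_, fun x _ G c hG hGZ => ?_⟩
  · have := (hmon (eq.symm k).2 (d - e (eq.symm k).1)).mul (he _ (htA (eq.symm k).1.2)).1
    rwa [tsub_add_cancel_of_le (hd _ (eq.symm k).1.2)] at this
  · have := (he _ (htA (eq.symm k).1.2)).2 z hz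
    simp only [val, F', map_mul] at this ⊢
    rw [this, mul_zero]
  · have hj : ∀ i, ∃ j, (x i).rep j ≠ 0 := fun i => Function.ne_iff.1 (x i).rep_nonzero
    choose j hj using hj
    have hGt : G ∈ Submodule.span (Poly n) (t : Set (Poly n)) := by
      rw [← ht]
      exact Submodule.subset_span ⟨c, hG, hGZ⟩
    obtain ⟨a, ha⟩ := Submodule.mem_span_finset'.1 hGt
    let b (g : t) : Poly n := if e g ≤ c then
      MvPolynomial.weightedHomogeneousComponent (fun v => Finsupp.single v.1 1) (c - e g) (a g)
      else 0
    have hG' : G = ∑ g : t, b g * g := by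
      have h1 := congrArg
        (MvPolynomial.weightedHomogeneousComponent (fun v => Finsupp.single v.1 1) c) ha
      rw [MvPolynomial.IsWeightedHomogeneous.weightedHomogeneousComponent_same hG, map_sum] at h1
      rw [← h1]
      refine Finset.sum_congr rfl fun g _ => ?_
      have hg := (he _ (htA g.2)).1
      have h3 := fun (p : Poly n) (m : ι →₀ ℕ) => MvPolynomial.decompose'_apply ℂ
        (fun v : (Σ i, Fin (n i)) => (Finsupp.single v.1 1 : ι →₀ ℕ)) p m
      by_cases hle : e g ≤ c
      · have h2 := DirectSum.coe_decompose_mul_of_right_mem_of_le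
          (MvPolynomial.weightedHomogeneousSubmodule ℂ
            (fun v : (Σ i, Fin (n i)) => (Finsupp.single v.1 1 : ι →₀ ℕ))) (a := a g) hg hle
        simp only [b, if_pos hle, smul_eq_mul]
        rw [← h3, ← h3]
        exact h2
      · have h2 := DirectSum.coe_decompose_mul_of_right_mem_of_not_le
          (MvPolynomial.weightedHomogeneousSubmodule ℂ
            (fun v : (Σ i, Fin (n i)) => (Finsupp.single v.1 1 : ι →₀ ℕ))) (a := a g) hg hle
        simp only [b, if_neg hle, smul_eq_mul, zero_mul]
        rw [← h3]
        exact h2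
    let C : (t × (∀ i, Fin (n i))) → Poly n := fun p =>
      if p.2 = j then b p.1 * mon j (e p.1) else 0
    refine ⟨mon j d, d, fun k => C (eq.symm k), c, hmon j d, ?_, fun k => ?_, add_comm _ _,
      fun y _ => ?_⟩
    · simp only [val, mon, map_prod, map_pow, MvPolynomial.eval_X]
      exact Finset.prod_ne_zero_iff.2 fun i _ => pow_ne_zero _ (hj i)
    · simp only [C, b]
      split_ifs with h1 h2
      · have := (MvPolynomial.weightedHomogeneousComponent_isWeightedHomogeneous
          (w := fun v : (Σ i, Fin (n i)) => (Finsupp.single v.1 1 : ι →₀ ℕ))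
          (c - e (eq.symm k).1) (a (eq.symm k).1)).mul (hmon j (e (eq.symm k).1))
        rwa [tsub_add_cancel_of_le h2] at this
      · rw [zero_mul]
        exact MvPolynomial.isWeightedHomogeneous_zero _ _ _
      · exact MvPolynomial.isWeightedHomogeneous_zero _ _ _
    · rw [Equiv.sum_comp eq.symm (fun p => val y (C p) * val y (F' p))]
      have : mon j d * G = ∑ p, C p * F' p := by
        rw [Fintype.sum_prod_type, hG', Finset.mul_sum]
        refine Finset.sum_congr rfl fun g _ => ?_
        rw [Finset.sum_eq_single j]
        · have := hadd j (e g) (d - e g)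
          rw [add_tsub_cancel_of_le (hd g g.2)] at this
          simp only [C, F', if_true, ← this]
          ring
        · intro j' _ hj'
          simp [C, hj']
        · simp
      simp only [val, ← map_mul, ← map_sum]
      rw [this]

/-- The numbers of coordinates of the factors of `MProj n × ℙ^(N - 1)`; the new factor has the
index `none`. -/
abbrev ext (n : ι → ℕ) (N : ℕ) : Option ι → ℕ := fun o => o.elim N n

/-- The projection `MProj n × ℙ^(N - 1) → MProj n`. -/
def base {N : ℕ} (y : MProj (ext n N)) : MProj n := fun i => y (some i)

/-- The projection `MProj n × ℙ^(N - 1) → ℙ^(N - 1)`. -/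
def last {N : ℕ} (y : MProj (ext n N)) : ℙ ℂ (Fin N → ℂ) := y none

/-- The graph of the map `[F 0 : … : F (N - 1)]`, over the points of `S` where some `F j` is not
zero. -/
def graph {N : ℕ} (S : Set (MProj n)) (F : Fin N → Poly n) : Set (MProj (ext n N)) :=
  {y | base y ∈ S ∧ ∃ hy : vals F (base y) ≠ 0, last y = Projectivization.mk ℂ _ hy}

/-- The blow-up of `S` along the common zeros of the `F j`: the closure in `S × ℙ^(N - 1)` of the
graph of `[F 0 : … : F (N - 1)]`. The blow-up morphism is `base`. If `Generates F S Z`, this is the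
blow-up of `S` along `Z`; up to isomorphism over `S` it does not depend on the choice of `F`. -/
def blowup {N : ℕ} (S : Set (MProj n)) (F : Fin N → Poly n) : Set (MProj (ext n N)) :=
  {y | base y ∈ S ∧ y ∈ zariskiClosure (graph S F)}

/-- The proper transform of `Y` in the blow-up `X'` of a variety along `Z`: the closure in `X'` of
the inverse image of `Y \ Z`. -/
def properTransform {N : ℕ} (X' : Set (MProj (ext n N))) (Y Z : Set (MProj n)) :
    Set (MProj (ext n N)) :=
  X' ∩ zariskiClosure {y ∈ X' | base y ∈ Y \ Z}

/-! ## Sextuples on the conic and polydiagonals -/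

/-- The six letters. -/
inductive Letter
  | A | B | C | D | E | F
  deriving DecidableEq

instance : Fintype Letter :=
  ⟨{.A, .B, .C, .D, .E, .F}, fun x => by cases x <;> decide⟩

/-- The point lies on the conic `z₀ z₂ = z₁²`. -/
def OnConic (p : ℙ ℂ (Fin 3 → ℂ)) : Prop := p.rep 0 * p.rep 2 = p.rep 1 ^ 2

/-- Six copies of the projective plane, indexed by the letters. -/
abbrev six : Letter → ℕ := fun _ => 3

/-- All labelled sextuples of points of the conic. -/
def sextuples : Set (MProj six) := {h | ∀ x, OnConic (h x)}

/-- A partition of the set of letters. -/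
abbrev LetterPartition : Type := Finpartition (Finset.univ : Finset Letter)

/-- The sizes of the parts. -/
def partitionType (π : LetterPartition) : Multiset ℕ := π.parts.val.map Finset.card

open Classical in
/-- The partition of the letters into the fibres of `h`. -/
def theta (h : MProj six) : LetterPartition :=
  Finpartition.ofSetoid (Setoid.ker (β := ℙ ℂ (Fin 3 → ℂ)) h)

/-- The polydiagonal of `π`. -/
def polydiagonal (π : LetterPartition) : Set (MProj six) :=
  {h ∈ sextuples | ∀ c ∈ π.parts, ∀ x ∈ c, ∀ y ∈ c, h x = h y}

/-- The union of all the polydiagonals of type `t`. -/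
def polydiagonals (t : Multiset ℕ) : Set (MProj six) :=
  ⋃ (π : LetterPartition) (_ : partitionType π = t), polydiagonal π

/-- The open set left after removing all polydiagonals of type `(3,2,1)` or `(4,1,1)`. -/
def Hcirc : Set (MProj six) := sextuples \ (polydiagonals {3, 2, 1} ∪ polydiagonals {4, 1, 1})

/-- The union of the open polydiagonals of type `(2,2,2)`. -/
def Z : Set (MProj six) := Hcirc ∩ polydiagonals {2, 2, 2}

/-- The union of the open polydiagonals of type `(2,2,1,1)` or `(3,1,1,1)`. -/
def Y : Set (MProj six) := Hcirc ∩ (polydiagonals {2, 2, 1, 1} ∪ polydiagonals {3, 1, 1, 1})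

/-- The proper transform of `Y` in the blow-up of `Hcirc` along `Z`, the latter being given by
generators `F₁` of the ideal of `Z`. -/
def Y' {N₁ : ℕ} (F₁ : Fin N₁ → Poly six) : Set (MProj (ext six N₁)) :=
  properTransform (blowup Hcirc F₁) Y Z

/-- The blow-up of `Blowup_Z(Hcirc)` along `Y'`, for generators `F₁` of the ideal of `Z` and
generators `F₂` of the ideal of `Y'`. -/
def X {N₁ N₂ : ℕ} (F₁ : Fin N₁ → Poly six) (F₂ : Fin N₂ → Poly (ext six N₁)) :
    Set (MProj (ext (ext six N₁) N₂)) :=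
  blowup (blowup Hcirc F₁) F₂

/-- The composite of the two blow-up morphisms, `β : X F₁ F₂ → Hcirc`. -/
def beta {N₁ N₂ : ℕ} (x : MProj (ext (ext six N₁) N₂)) : MProj six := base (base x)

/-- The fibre of `β` over `h`. -/
def fibre {N₁ N₂ : ℕ} (F₁ : Fin N₁ → Poly six) (F₂ : Fin N₂ → Poly (ext six N₁))
    (h : MProj six) : Set (MProj (ext (ext six N₁) N₂)) :=
  {x ∈ X F₁ F₂ | beta x = h}

/-! ## Pascals

A line in the projective plane is given by its line coordinates, a point of the dual plane; the
point `p` lies on the line `ℓ` iff `ℓ.orthogonal p`. `Projectivization.cross` of two distinct points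
is the line joining them, and of two distinct lines it is their point of intersection. -/

/-- The intersection of the two lines that join crosswise the letters of the columns `i`, `j` of
the array `s`. -/
def crossHair (s : Matrix (Fin 2) (Fin 3) Letter) (h : MProj six) (i j : Fin 3) :
    ℙ ℂ (Fin 3 → ℂ) :=
  Projectivization.cross (Projectivization.cross (h (s 0 i)) (h (s 1 j)))
    (Projectivization.cross (h (s 0 j)) (h (s 1 i)))

/-- `ℓ` is the Pascal line of the array `s` for the six distinct points `h`: it contains the three
cross-hair intersections. -/
def IsPascal (s : Matrix (Fin 2) (Fin 3) Letter) (h : MProj six) (ℓ : ℙ ℂ (Fin 3 → ℂ)) : Prop :=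
  ∀ i j, i < j → ℓ.orthogonal (crossHair s h i j)

/-- `q_s(x)` is defined and equal to `ℓ`, where `q_s` is the extension to `X F₁ F₂` of the rational
map `p_s` which sends six distinct points to their Pascal line: on some open neighbourhood `W` of
`x` in `X F₁ F₂` there is a regular map to the dual plane that has the value `ℓ` at `x`, and that
gives the Pascal of `β w` for all `w ∈ W` for which the six points `β w` are distinct. -/
def PascalValue {N₁ N₂ : ℕ} (F₁ : Fin N₁ → Poly six) (F₂ : Fin N₂ → Poly (ext six N₁))
    (s : Matrix (Fin 2) (Fin 3) Letter) (x : MProj (ext (ext six N₁) N₂))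
    (ℓ : ℙ ℂ (Fin 3 → ℂ)) : Prop :=
  ∃ W, IsOpenIn W (X F₁ F₂) ∧ x ∈ W ∧
    ∃ φ : MProj (ext (ext six N₁) N₂) → ℙ ℂ (Fin 3 → ℂ), IsRegular φ W ∧ φ x = ℓ ∧
      ∀ w ∈ W, Function.Injective (β := ℙ ℂ (Fin 3 → ℂ)) (beta w) →
        IsPascal s (beta w) (φ w)

/-- The projective line, as a product of one factor. -/
abbrev one : Unit → ℕ := fun _ => 2

/-- The (dual) projective plane, as a product of one factor. -/
abbrev plane : Unit → ℕ := fun _ => 3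

/-- The pencil of lines through the point `p`. -/
def pencil (p : ℙ ℂ (Fin 3 → ℂ)) : Set (MProj plane) :=
  {ℓ | Projectivization.orthogonal (ℓ ()) p}

end Pascal

end

/-! Only the diagonals A = B and E = F matter near `h`. Since `h` lies off Z, the first blow-up
changes nothing there, and Y is near `h` the single locus A = B, E = F. On the conic the determinant
of three points is the product of the brackets of their parameters, so the equations of this locus
near `h` are α = `dt .A .B .D` and ε = `dt .E .F .C`, the other bracket factors being nonzero. The
second blow-up therefore replaces `h` by a projective line with coordinate [z₀ : z₁], the limit of
[α : ε].

The Pascal line joins AD ∩ CF to BD ∩ CE. Expanding this join (`cross_cross_cross`) gives α ·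
det(C,F,D) · CE + ε · det(A,C,D) · BD. On the blow-up the common vanishing of α and ε can be divided
out, which leaves z₀ det(C,F,D) · CE + z₁ det(A,C,D) · BD. At `h` both determinants are nonzero, CE
is the line NP and BD is the line MQ, so this is a linear parametrization of the pencil through MQ ∩
NP.

The generators `F₁`, `F₂` are arbitrary, so α and ε must be compared with `F₂`. By
`exists_cofactors`, up to a unit the restricted generators are P α + Q ε; by
`Setting.nonempty_localEquations` the matrix (P, Q) has rank two at `h`. Then
`LocalEquations.mem_fibre_iff` identifies the fibre with the projectivized column space of (P, Q).
Cramer's rule recovers α and ε from the coordinates of the blow-up and yields forms extending the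
Pascal map (`LocalEquations.ev_line`). The extension is unique because the points over distinct
sextuples are dense (`LocalEquations.pascalValue_iff`), and `isIsoOn_of_linear` turns the linear
parametrizations into isomorphisms. -/

noncomputable section

namespace Pascal

open MvPolynomial

variable {ι κ : Type} {n : ι → ℕ} {m : κ → ℕ}

/-! ## Forms and their values at chosen homogeneous coordinates -/

/-- Evaluation at a choice of homogeneous coordinates. -/
def ev (w : ∀ i, Fin (n i) → ℂ) : Poly n →ₐ[ℂ] ℂ := MvPolynomial.aeval (fun s => w s.1 s.2)

theorem ev_X (w : ∀ i, Fin (n i) → ℂ) (s : Σ i, Fin (n i)) :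
    ev w (MvPolynomial.X s : Poly n) = w s.1 s.2 := by
  simp [ev]

theorem val_eq_ev (x : MProj n) (G : Poly n) : val x G = ev (fun i => (x i).rep) G := by
  simp only [val, ev, MvPolynomial.aeval_eq_eval]

theorem ev_aeval (w : ∀ k, Fin (m k) → ℂ) (σ : (Σ i, Fin (n i)) → Poly m) (G : Poly n) :
    ev w (MvPolynomial.aeval σ G) = ev (fun i j => ev w (σ ⟨i, j⟩)) G := by
  have : (ev w).comp (MvPolynomial.aeval σ) = ev (fun i j => ev w (σ ⟨i, j⟩)) := by
    ext s
    simp [ev_X]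
  exact DFunLike.congr_fun this G

theorem continuous_ev (G : Poly n) {f : ℂ → ∀ i, Fin (n i) → ℂ}
    (hf : ∀ i j, Continuous fun t => f t i j) : Continuous fun t => ev (f t) G := by
  induction G using MvPolynomial.induction_on with
  | C a => simpa [ev] using continuous_const
  | add p q hp hq => simp only [map_add]; exact hp.add hq
  | mul_X p s hp => simp only [map_mul, ev_X]; exact hp.mul (hf s.1 s.2)

namespace IsForm

variable {G H : Poly n} {d e : ι →₀ ℕ}

theorem mul (hG : IsForm G d) (hH : IsForm H e) : IsForm (G * H) (d + e) :=
  IsWeightedHomogeneous.mul hG hH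

theorem add (hG : IsForm G d) (hH : IsForm H d) : IsForm (G + H) d :=
  IsWeightedHomogeneous.add hG hH

theorem sub (hG : IsForm G d) (hH : IsForm H d) : IsForm (G - H) d :=
  IsWeightedHomogeneous.sub hG hH

theorem neg (hG : IsForm G d) : IsForm (-G) d :=
  IsWeightedHomogeneous.neg hG

theorem pow (hG : IsForm G d) (k : ℕ) : IsForm (G ^ k) (k • d) :=
  IsWeightedHomogeneous.pow hG k

theorem sum {τ : Type*} (s : Finset τ) {f : τ → Poly n} (hf : ∀ t ∈ s, IsForm (f t) d) :
    IsForm (∑ t ∈ s, f t) d :=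
  IsWeightedHomogeneous.sum s f d hf

theorem prod {τ : Type*} (s : Finset τ) {f : τ → Poly n} {d : τ → ι →₀ ℕ}
    (hf : ∀ t ∈ s, IsForm (f t) (d t)) : IsForm (∏ t ∈ s, f t) (∑ t ∈ s, d t) :=
  IsWeightedHomogeneous.prod s f d hf

theorem C_mul (hG : IsForm G d) (c : ℂ) : IsForm (C c * G) d :=
  IsWeightedHomogeneous.C_mul hG c

theorem X (s : Σ i, Fin (n i)) : IsForm (MvPolynomial.X s : Poly n) (Finsupp.single s.1 1) :=
  isWeightedHomogeneous_X ℂ _ s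

theorem C (c : ℂ) : IsForm (MvPolynomial.C c : Poly n) 0 :=
  isWeightedHomogeneous_C _ c

theorem degree_eq (hG : IsForm G d) {a : (Σ i, Fin (n i)) →₀ ℕ} (ha : a ∈ G.support) :
    a.sum (fun s k => k • (Finsupp.single s.1 1 : ι →₀ ℕ)) = d := by
  have := hG (mem_support_iff.1 ha)
  rwa [Finsupp.weight_apply] at this

theorem aeval {σ : (Σ i, Fin (n i)) → Poly m} {s : ι → κ →₀ ℕ}
    (hσ : ∀ v, IsForm (σ v) (s v.1)) (hG : IsForm G d) :
    IsForm (MvPolynomial.aeval σ G) (Finsupp.linearCombination ℕ s d) := by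
  rw [MvPolynomial.aeval_def, MvPolynomial.eval₂_eq]
  refine IsForm.sum _ fun a ha => IsForm.C_mul ?_ _
  have h1 : Finsupp.linearCombination ℕ s d = ∑ v ∈ a.support, a v • s v.1 := by
    rw [← hG.degree_eq ha, Finsupp.sum, map_sum]
    simp
  rw [h1]
  exact IsForm.prod _ fun v _ => (hσ v).pow _

theorem ev_smul (hG : IsForm G d) (c : ι → ℂ) (w : ∀ i, Fin (n i) → ℂ) :
    ev (fun i => c i • w i) G = (d.prod fun i k => c i ^ k) * ev w G := by
  simp only [ev, MvPolynomial.aeval_def, MvPolynomial.eval₂_eq, Finset.mul_sum]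
  refine Finset.sum_congr rfl fun a ha => ?_
  have h1 : (d.prod fun i k => c i ^ k) = ∏ v ∈ a.support, c v.1 ^ a v := by
    rw [← hG.degree_eq ha, Finsupp.sum, ← Finsupp.prod_finsetSum_index]
    · simp
    · simp
    · intro i k l
      exact pow_add _ _ _
  rw [h1]
  simp only [Pi.smul_apply, smul_eq_mul, mul_pow, Finset.prod_mul_distrib]
  ring

end IsForm

/-- `w` is a choice of homogeneous coordinates of `x`. -/
def Lift (w : ∀ i, Fin (n i) → ℂ) (x : MProj n) : Prop :=
  ∀ i, ∃ h : w i ≠ 0, x i = Projectivization.mk ℂ (w i) h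

theorem lift_rep (x : MProj n) : Lift (fun i => (x i).rep) x :=
  fun i => ⟨(x i).rep_nonzero, (Projectivization.mk_rep _).symm⟩

theorem exists_lift {w : ∀ i, Fin (n i) → ℂ} (hw : ∀ i, w i ≠ 0) : ∃ x : MProj n, Lift w x :=
  ⟨fun i => Projectivization.mk ℂ (w i) (hw i), fun i => ⟨hw i, rfl⟩⟩

theorem Lift.unique {w : ∀ i, Fin (n i) → ℂ} {x y : MProj n} (hx : Lift w x) (hy : Lift w y) :
    x = y := by
  funext i
  rw [(hx i).2, (hy i).2]

/-- The scalar depends on the multidegree alone, not on the form. Hence a tuple of forms of one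
multidegree is rescaled as a whole and its projective value can be computed at any coordinates. -/
theorem Lift.exists_scale {w : ∀ i, Fin (n i) → ℂ} {x : MProj n} (hw : Lift w x) (d : ι →₀ ℕ) :
    ∃ c : ℂ, c ≠ 0 ∧ ∀ G : Poly n, IsForm G d → val x G = c * ev w G := by
  have h : ∀ i, ∃ a : ℂ, a ≠ 0 ∧ a • w i = (x i).rep := by
    intro i
    obtain ⟨h0, h1⟩ := hw i
    obtain ⟨a, ha⟩ := Projectivization.exists_smul_eq_mk_rep ℂ (w i) h0
    exact ⟨a, a.ne_zero, by rw [h1, ← ha]; rfl⟩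
  choose a ha0 ha using h
  refine ⟨d.prod fun i k => a i ^ k, Finset.prod_ne_zero_iff.2 fun i _ => pow_ne_zero _ (ha0 i),
    fun G hG => ?_⟩
  rw [val_eq_ev, ← hG.ev_smul]
  simp only [ha]

theorem Lift.val_eq_zero {w : ∀ i, Fin (n i) → ℂ} {x : MProj n} (hw : Lift w x) {d : ι →₀ ℕ}
    {G : Poly n} (hG : IsForm G d) : val x G = 0 ↔ ev w G = 0 := by
  obtain ⟨c, hc, h⟩ := hw.exists_scale d
  rw [h G hG, mul_eq_zero, or_iff_right hc]

theorem Lift.vals_eq {N : ℕ} {w : ∀ i, Fin (n i) → ℂ} {x : MProj n} (hw : Lift w x) {d : ι →₀ ℕ}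
    {F : Fin N → Poly n} (hF : ∀ j, IsForm (F j) d) :
    ∃ c : ℂ, c ≠ 0 ∧ vals F x = c • fun j => ev w (F j) := by
  obtain ⟨c, hc, h⟩ := hw.exists_scale d
  exact ⟨c, hc, funext fun j => h _ (hF j)⟩

theorem mk_smul_eq {N : ℕ} {v w : Fin N → ℂ} {c : ℂ} (hv : v ≠ 0) (hw : w ≠ 0) (h : v = c • w) :
    Projectivization.mk ℂ v hv = Projectivization.mk ℂ w hw :=
  (Projectivization.mk_eq_mk_iff' ℂ _ _ _ _).2 ⟨c, h.symm⟩

theorem mk_eq_mk_of_minors {N : ℕ} {v w : Fin N → ℂ} (hv : v ≠ 0) (hw : w ≠ 0)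
    (h : ∀ i j, v i * w j = v j * w i) :
    Projectivization.mk ℂ v hv = Projectivization.mk ℂ w hw := by
  obtain ⟨j, hj⟩ := Function.ne_iff.1 hw
  refine mk_smul_eq (c := v j / w j) hv hw (funext fun i => ?_)
  have hj' : w j ≠ 0 := hj
  rw [Pi.smul_apply, smul_eq_mul, div_mul_eq_mul_div, eq_div_iff hj', h]

/-- The homogeneous component of a relation between forms. -/
theorem exists_isForm_of_mem_span_pair {G p q : Poly n} {a b c e : ι →₀ ℕ}
    (hp : IsForm p a) (hq : IsForm q b) (hG : IsForm G (c + a)) (hce : c + a = e + b)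
    (h : G ∈ Ideal.span {p, q}) :
    ∃ r s : Poly n, IsForm r c ∧ IsForm s e ∧ G = r * p + s * q := by
  classical
  let wt : (Σ i, Fin (n i)) → ι →₀ ℕ := fun v => Finsupp.single v.1 1
  let := MvPolynomial.weightedGradedAlgebra (R := ℂ) wt
  have key : ∀ (r p : Poly n) (a c : ι →₀ ℕ), IsForm p a →
      weightedHomogeneousComponent wt (c + a) (r * p) =
        weightedHomogeneousComponent wt c r * p := by
    intro r p a c hp
    have h3 := fun (p : Poly n) (m : ι →₀ ℕ) => MvPolynomial.decompose'_apply ℂ wt p m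
    have h2 := DirectSum.coe_decompose_mul_of_right_mem_of_le
      (MvPolynomial.weightedHomogeneousSubmodule ℂ wt) (a := r) (b := p) (i := a) (n := c + a) hp
      le_add_self
    rw [add_tsub_cancel_right] at h2
    rw [← h3, ← h3]
    exact h2
  obtain ⟨r, s, hrs⟩ := Ideal.mem_span_pair.1 h
  refine ⟨_, _, weightedHomogeneousComponent_isWeightedHomogeneous (w := wt) c r,
    weightedHomogeneousComponent_isWeightedHomogeneous (w := wt) e s, ?_⟩
  have h1 := congrArg (weightedHomogeneousComponent wt (c + a)) hrs
  rw [IsWeightedHomogeneous.weightedHomogeneousComponent_same hG, map_add, key r p a c hp, hce,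
    key s q b e hq] at h1
  exact h1.symm

theorem aeval_sub_aeval_mem {I : Ideal (Poly m)} {σ σ' : (Σ i, Fin (n i)) → Poly m}
    (h : ∀ v, σ v - σ' v ∈ I) (G : Poly n) :
    MvPolynomial.aeval σ G - MvPolynomial.aeval σ' G ∈ I := by
  rw [← Ideal.Quotient.mk_eq_mk_iff_sub_mem]
  have : (Ideal.Quotient.mkₐ ℂ I).comp (MvPolynomial.aeval σ) =
      (Ideal.Quotient.mkₐ ℂ I).comp (MvPolynomial.aeval σ') := by
    ext v
    simpa using (Ideal.Quotient.mk_eq_mk_iff_sub_mem _ _).2 (h v)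
  exact DFunLike.congr_fun this G

/-! ## Zariski closures -/

theorem subset_zariskiClosure (S : Set (MProj n)) : S ⊆ zariskiClosure S :=
  fun _ hx _ _ _ h => h _ hx

theorem zariskiClosure_subset {S S' : Set (MProj n)} (h : S ⊆ zariskiClosure S') :
    zariskiClosure S ⊆ zariskiClosure S' :=
  fun _ hx G d hG h0 => hx G d hG fun _ hy => h hy G d hG h0

/-- Openness of `W` supplies a form that vanishes on `S \ W` but not at `x`; multiplying by it
extends a vanishing on `T ∩ W` to all of `T`. This makes density usable inside a neighbourhood. -/
theorem mem_zariskiClosure_inter {W S T : Set (MProj n)} {x : MProj n} (hW : IsOpenIn W S)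
    (hx : x ∈ W) (hT : x ∈ zariskiClosure T) (hTS : T ⊆ S) : x ∈ zariskiClosure (T ∩ W) := by
  intro G d hG h0
  have h1 : x ∉ zariskiClosure (S \ W) := fun h => (hW.2 ⟨hW.1 hx, h⟩).2 hx
  simp only [zariskiClosure, Set.mem_ofPred_eq, not_forall] at h1
  obtain ⟨H, e, hH, hH0, hHx⟩ := h1
  have h2 := hT (G * H) _ (hG.mul hH) fun y hy => by
    rw [val_eq_ev, map_mul, ← val_eq_ev, ← val_eq_ev]
    by_cases hyW : y ∈ W
    · rw [h0 y ⟨hy, hyW⟩, zero_mul]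
    · rw [hH0 y ⟨hTS hy, hyW⟩, mul_zero]
  rw [val_eq_ev, map_mul, ← val_eq_ev, ← val_eq_ev] at h2
  exact (mul_eq_zero.1 h2).resolve_right hHx

theorem isOpenIn_vals_ne_zero {N : ℕ} (S : Set (MProj n)) {d : ι →₀ ℕ} {F : Fin N → Poly n}
    (hF : ∀ j, IsForm (F j) d) : IsOpenIn {x ∈ S | vals F x ≠ 0} S := by
  refine ⟨fun x hx => hx.1, fun x hx => ⟨hx.1, fun h => h.2 (funext fun j => ?_)⟩⟩
  refine hx.2 _ _ (hF j) fun y hy => ?_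
  by_contra h0
  exact hy.2 ⟨hy.1, fun h1 => h0 (congrFun h1 j)⟩

/-! ## Graphs -/

/-- Homogeneous coordinates of a point of `MProj n × ℙ^(N - 1)`. -/
def snoc {N : ℕ} (w : ∀ i, Fin (n i) → ℂ) (y : Fin N → ℂ) : ∀ o, Fin (ext n N o) → ℂ
  | some i => w i
  | none => y

/-- The point of the graph of `F` above `w`, in homogeneous coordinates. -/
def gr {N : ℕ} (F : Fin N → Poly n) (w : ∀ i, Fin (n i) → ℂ) : ∀ o, Fin (ext n N o) → ℂ :=
  snoc w fun j => ev w (F j)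

/-- A polynomial on the base, as a polynomial on the product. -/
def emb (N : ℕ) : Poly n →ₐ[ℂ] Poly (ext n N) :=
  MvPolynomial.aeval fun s => MvPolynomial.X ⟨some s.1, s.2⟩

/-- The coordinates of the new factor. -/
def newX (n : ι → ℕ) {N : ℕ} (j : Fin N) : Poly (ext n N) := MvPolynomial.X ⟨none, j⟩

/-- Restriction of a polynomial to the graph of `F`. -/
def res {N : ℕ} (F : Fin N → Poly n) : Poly (ext n N) →ₐ[ℂ] Poly n :=
  MvPolynomial.aeval fun s => match s with
    | ⟨some i, j⟩ => MvPolynomial.X ⟨i, j⟩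
    | ⟨none, j⟩ => F j

theorem ev_emb {N : ℕ} (w : ∀ i, Fin (n i) → ℂ) (y : Fin N → ℂ) (G : Poly n) :
    ev (snoc w y) (emb N G) = ev w G := by
  rw [emb, ev_aeval]
  simp only [ev_X]
  rfl

theorem ev_newX {N : ℕ} (w : ∀ i, Fin (n i) → ℂ) (y : Fin N → ℂ) (j : Fin N) :
    ev (snoc w y) (newX n j) = y j := by
  rw [newX, ev_X]
  rfl

theorem ev_res {N : ℕ} (F : Fin N → Poly n) (w : ∀ i, Fin (n i) → ℂ) (G : Poly (ext n N)) :
    ev w (res F G) = ev (gr F w) G := by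
  rw [res, ev_aeval]
  congr 1
  congr 1
  funext o j
  cases o with
  | none => rfl
  | some i => simp only [ev_X]; rfl

/-- The multidegree on the product of a form on the base. -/
def embDeg : (ι →₀ ℕ) →ₗ[ℕ] (Option ι →₀ ℕ) :=
  Finsupp.linearCombination ℕ fun i => Finsupp.single (some i) 1

theorem IsForm.emb {G : Poly n} {d : ι →₀ ℕ} (hG : IsForm G d) (N : ℕ) :
    IsForm (emb N G) (embDeg d) :=
  IsForm.aeval (fun s => IsForm.X (n := ext n N) ⟨some s.1, s.2⟩) hG

theorem IsForm.newX {N : ℕ} (j : Fin N) : IsForm (newX n j) (Finsupp.single none 1) :=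
  IsForm.X (n := ext n N) ⟨none, j⟩

theorem IsForm.exists_res {N : ℕ} {F : Fin N → Poly n} {d : ι →₀ ℕ} (hF : ∀ j, IsForm (F j) d)
    (e : Option ι →₀ ℕ) : ∃ a, ∀ G, IsForm G e → IsForm (res F G) a := by
  let s : Option ι → ι →₀ ℕ := fun o => o.elim d fun i => Finsupp.single i 1
  refine ⟨Finsupp.linearCombination ℕ s e, fun G hG => IsForm.aeval (fun v => ?_) hG⟩
  obtain ⟨o, j⟩ := v
  cases o with
  | none => exact hF j
  | some i => exact IsForm.X _

theorem Lift.base {N : ℕ} {w : ∀ i, Fin (n i) → ℂ} {y : Fin N → ℂ} {x : MProj (ext n N)}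
    (h : Lift (snoc w y) x) : Lift w (base x) :=
  fun i => h (some i)

theorem lift_snoc_iff {N : ℕ} {w : ∀ i, Fin (n i) → ℂ} {y : Fin N → ℂ} {x : MProj (ext n N)} :
    Lift (snoc w y) x ↔
      Lift w (Pascal.base x) ∧ ∃ h : y ≠ 0, last x = Projectivization.mk ℂ y h := by
  constructor
  · exact fun h => ⟨h.base, h none⟩
  · rintro ⟨h1, h2⟩ (_ | i)
    · exact h2
    · exact h1 i

theorem mem_graph_iff {N : ℕ} {S : Set (MProj n)} {F : Fin N → Poly n} {d : ι →₀ ℕ}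
    (hF : ∀ j, IsForm (F j) d) {w : ∀ i, Fin (n i) → ℂ} {x : MProj (ext n N)}
    (hw : Lift w (base x)) : x ∈ graph S F ↔ base x ∈ S ∧ Lift (gr F w) x := by
  obtain ⟨c, hc, h⟩ := hw.vals_eq hF
  rw [gr, lift_snoc_iff]
  constructor
  · rintro ⟨h1, h2, h3⟩
    have h4 : (fun j => ev w (F j)) ≠ 0 := by
      intro h0
      rw [h, h0, smul_zero] at h2
      exact h2 rfl
    exact ⟨h1, hw, h4, h3.trans (mk_smul_eq _ _ h)⟩
  · rintro ⟨h1, _, h4, h3⟩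
    have h2 : vals F (base x) ≠ 0 := by
      rw [h]
      exact smul_ne_zero hc h4
    exact ⟨h1, h2, h3.trans (mk_smul_eq _ _ h).symm⟩

theorem graph_subset_blowup {N : ℕ} (S : Set (MProj n)) (F : Fin N → Poly n) :
    graph S F ⊆ blowup S F :=
  fun _ hx => ⟨hx.1, subset_zariskiClosure _ hx⟩

theorem base_snoc_rep {N : ℕ} (x : MProj (ext n N)) :
    (fun i => (x i).rep) = snoc (fun i => (base x i).rep) (last x).rep := by
  funext o
  cases o <;> rfl

theorem val_emb {N : ℕ} (x : MProj (ext n N)) (G : Poly n) : val x (emb N G) = val (base x) G := by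
  rw [val_eq_ev, base_snoc_rep, ev_emb, val_eq_ev]

theorem val_newX {N : ℕ} (x : MProj (ext n N)) (j : Fin N) :
    val x (newX n j) = (last x).rep j := by
  rw [val_eq_ev, base_snoc_rep, ev_newX]

theorem val_mul (x : MProj n) (G H : Poly n) : val x (G * H) = val x G * val x H := by
  simp [val]

theorem val_sub (x : MProj n) (G H : Poly n) : val x (G - H) = val x G - val x H := by
  simp [val]

/-- Over the points where `F` does not vanish the blow-up is the graph of `F`. -/
theorem mem_graph_of_mem_blowup {N : ℕ} {S : Set (MProj n)} {F : Fin N → Poly n} {d : ι →₀ ℕ}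
    (hF : ∀ j, IsForm (F j) d) {x : MProj (ext n N)} (hx : x ∈ blowup S F)
    (h0 : vals F (base x) ≠ 0) : x ∈ graph S F := by
  refine ⟨hx.1, h0, ?_⟩
  rw [← Projectivization.mk_rep (last x)]
  refine mk_eq_mk_of_minors _ _ fun i j => ?_
  have := hx.2 (newX n i * emb N (F j) - newX n j * emb N (F i)) _
    (((IsForm.newX i).mul ((hF j).emb N)).sub ((IsForm.newX j).mul ((hF i).emb N))) ?_
  · rwa [val_sub, val_mul, val_mul, val_emb, val_emb, val_newX, val_newX, sub_eq_zero] at this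
  · rintro y ⟨_, h1, h2⟩
    rw [val_sub, val_mul, val_mul, val_emb, val_emb, val_newX, val_newX, h2]
    obtain ⟨a, ha⟩ := Projectivization.exists_smul_eq_mk_rep ℂ _ h1
    rw [← ha]
    simp only [vals, Units.smul_def, Pi.smul_apply, smul_eq_mul]
    ring

/-- If `S₀` is dense in `S`, the graph over `S₀` is dense in the graph over `S`. -/
theorem blowup_subset_zariskiClosure {N : ℕ} {S S₀ : Set (MProj n)} {F : Fin N → Poly n}
    {d : ι →₀ ℕ} (hF : ∀ j, IsForm (F j) d) (h : S ⊆ zariskiClosure S₀) :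
    blowup S F ⊆ zariskiClosure (graph S₀ F) := by
  intro x hx
  refine zariskiClosure_subset ?_ hx.2
  intro y hy G e hG hG0
  obtain ⟨h1, h2, _⟩ := id hy
  obtain ⟨j, hj⟩ := Function.ne_iff.1 h2
  obtain ⟨a, ha⟩ := IsForm.exists_res hF e
  -- The factor `F j` makes the product vanish also at the points of `S₀` where the graph is not
  -- defined; it is nonzero at `base y`, so it can be cancelled there.
  have h4 := h h1 (res F G * F j) _ ((ha G hG).mul (hF j)) ?_
  · rw [val_mul] at h4
    have h5 := (mul_eq_zero.1 h4).resolve_right hj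
    rw [val_eq_ev, ev_res] at h5
    have h6 := ((mem_graph_iff hF (lift_rep (base y))).1 hy).2
    exact (h6.val_eq_zero hG).2 h5
  · intro z hz
    by_cases hv : vals F z = 0
    · rw [val_mul, show val z (F j) = 0 from congrFun hv j, mul_zero]
    · have hw := lift_rep z
      obtain ⟨c, hc, hvz⟩ := hw.vals_eq hF
      have hne : (fun j => ev (fun i => (z i).rep) (F j)) ≠ 0 := by
        intro h0
        rw [hvz, h0, smul_zero] at hv
        exact hv rfl
      obtain ⟨t, ht⟩ := exists_lift (w := gr F fun i => (z i).rep) (by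
        rintro (_ | i)
        · exact hne
        · exact (z i).rep_nonzero)
      have hb : base t = z := ht.base.unique hw
      have htg : t ∈ graph S₀ F :=
        (mem_graph_iff hF (w := fun i => (z i).rep) (hb ▸ hw)).2 ⟨hb ▸ hz, ht⟩
      rw [val_mul, val_eq_ev, ev_res, (ht.val_eq_zero hG).1 (hG0 t htg), zero_mul]

/-- The relation in `Generates`, at arbitrary homogeneous coordinates. -/
theorem Generates.exists_relation {N : ℕ} {F : Fin N → Poly n} {S Z : Set (MProj n)}
    (hF : Generates F S Z) {x : MProj n} (hx : x ∈ S) {G : Poly n} {e : ι →₀ ℕ} (hG : IsForm G e)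
    (hGZ : ∀ z ∈ Z, val z G = 0) :
    ∃ (U : Poly n) (a : ι →₀ ℕ) (C : Fin N → Poly n), IsForm U a ∧ val x U ≠ 0 ∧
      ∀ y ∈ S, ∀ w, Lift w y → ev w U * ev w G = ∑ j, ev w (C j) * ev w (F j) := by
  obtain ⟨d, hd, _, h⟩ := hF
  obtain ⟨U, a, C, c, hU, hUx, hC, hc, hrel⟩ := h x hx G e hG hGZ
  refine ⟨U, a, C, hU, hUx, fun y hy w hw => ?_⟩
  have h1 : IsForm (U * G - ∑ j, C j * F j) (a + e) :=
    (hU.mul hG).sub (IsForm.sum _ fun j _ => hc ▸ (hC j).mul (hd j))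
  have h2 := (hw.val_eq_zero h1).1 (by
    have := hrel y hy
    simp only [val] at this ⊢
    simpa [sub_eq_zero] using this)
  simpa [sub_eq_zero] using h2

theorem isRegular_const {N : ℕ} (p : ℙ ℂ (Fin N → ℂ)) (S : Set (MProj n)) :
    IsRegular (fun _ => p) S := by
  intro x _
  have h : ∀ y : MProj n, vals (fun j => (C (p.rep j) : Poly n)) y = p.rep := by
    intro y
    funext j
    simp [vals, val]
  refine ⟨0, fun j => C (p.rep j), fun j => IsForm.C _, ?_, fun y _ hy => ?_⟩
  · rw [h]
    exact p.rep_nonzero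
  · simp only [h, Projectivization.mk_rep]

end Pascal

namespace Pascal

open Matrix

/-! ## Parametrized points of the conic -/

/-- Coordinates of the point of the conic with parameter `[a 0 : a 1]`. -/
def conicVec {R : Type*} [CommRing R] (a : Fin 2 → R) : Fin 3 → R :=
  ![a 0 ^ 2, a 0 * a 1, a 1 ^ 2]

/-- The bracket of two parameters. -/
def br (a b : Fin 2 → ℂ) : ℂ := a 0 * b 1 - a 1 * b 0

/-- The polar form of the conic. -/
def bil {R : Type*} [CommRing R] (p q : Fin 3 → R) : R := p 0 * q 2 - 2 * p 1 * q 1 + p 2 * q 0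

theorem exists_conicVec {z : Fin 3 → ℂ} (h : z 0 * z 2 = z 1 ^ 2) : ∃ a, z = conicVec a := by
  obtain ⟨s, hs⟩ := IsAlgClosed.exists_pow_nat_eq (z 0) two_pos
  obtain ⟨t, ht⟩ := IsAlgClosed.exists_pow_nat_eq (z 2) two_pos
  have h1 : (s * t - z 1) * (s * t + z 1) = 0 := by
    linear_combination h + s ^ 2 * ht + z 2 * hs
  rcases mul_eq_zero.1 h1 with h2 | h2
  · refine ⟨![s, t], funext fun i => ?_⟩
    fin_cases i <;> simp [conicVec, hs, ht]
    linear_combination -h2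
  · refine ⟨![s, -t], funext fun i => ?_⟩
    fin_cases i <;> simp [conicVec, hs, ht]
    linear_combination h2

/-- The bracket of two parameters is not a polynomial in the coordinates of the two points, but its
square is. This is how coincidence of points is detected by forms. -/
theorem bil_conicVec (a b : Fin 2 → ℂ) : bil (conicVec a) (conicVec b) = br a b ^ 2 := by
  simp [bil, conicVec, br]
  ring

theorem conicVec_eq_zero {a : Fin 2 → ℂ} (h : conicVec a = 0) : a = 0 := by
  have h0 := congrFun h 0
  have h2 := congrFun h 2
  simp [conicVec] at h0 h2
  funext i
  fin_cases i
  · exact h0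
  · exact h2

theorem cross_conicVec_eq_zero_iff {a b : Fin 2 → ℂ} (ha : a ≠ 0) (hb : b ≠ 0) :
    conicVec a ⨯₃ conicVec b = 0 ↔ br a b = 0 := by
  have h : conicVec a ⨯₃ conicVec b = br a b • ![a 1 * b 1, -(a 0 * b 1 + a 1 * b 0), a 0 * b 0] := by
    rw [cross_apply]
    funext i
    fin_cases i <;> simp [conicVec, br] <;> ring
  rw [h, smul_eq_zero, or_iff_left_iff_imp]
  intro h0
  have h1 := congrFun h0 0
  have h2 := congrFun h0 1
  have h3 := congrFun h0 2
  simp at h1 h2 h3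
  have hb' : ¬ (b 0 = 0 ∧ b 1 = 0) := fun hb' => hb (by
    funext i; fin_cases i
    · exact hb'.1
    · exact hb'.2)
  have ha' : ¬ (a 0 = 0 ∧ a 1 = 0) := fun ha' => ha (by
    funext i; fin_cases i
    · exact ha'.1
    · exact ha'.2)
  rcases h1 with h1 | h1 <;> rcases h3 with h3 | h3 <;> simp_all

theorem mk_conicVec_eq_iff {a b : Fin 2 → ℂ} (ha : conicVec a ≠ 0) (hb : conicVec b ≠ 0) :
    Projectivization.mk ℂ _ ha = Projectivization.mk ℂ _ hb ↔ br a b = 0 := by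
  rw [Projectivization.mk_eq_mk_iff_crossProduct_eq_zero]
  refine cross_conicVec_eq_zero_iff ?_ ?_
  · rintro rfl
    exact ha (by funext i; fin_cases i <;> simp [conicVec])
  · rintro rfl
    exact hb (by funext i; fin_cases i <;> simp [conicVec])

/-- Homogeneous coordinates of the sextuple with parameters `a`. -/
def cv (a : Letter → Fin 2 → ℂ) : ∀ x, Fin (six x) → ℂ := fun x => conicVec (a x)

/-- Parameters are chosen once for each point of the conic and not for each letter, so coinciding
points get equal parameters and not merely proportional ones. -/
theorem exists_rep_eq_cv {h : MProj six} (hh : h ∈ sextuples) :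
    ∃ a, (fun x => (h x).rep) = cv a ∧ ∀ i j, h i = h j → a i = a j := by
  choose f hf using fun p : {p // OnConic p} => exists_conicVec p.2
  refine ⟨fun x => f ⟨h x, hh x⟩, funext fun x => hf ⟨h x, hh x⟩, fun i j hij => ?_⟩
  simp only [hij]

theorem Lift.mem_sextuples {a : Letter → Fin 2 → ℂ} {y : MProj six} (h : Lift (cv a) y) :
    y ∈ sextuples := by
  intro x
  obtain ⟨h0, h1⟩ := h x
  obtain ⟨c, hc⟩ := Projectivization.exists_smul_eq_mk_rep ℂ (cv a x) h0
  rw [OnConic, h1, ← hc]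
  simp [cv, conicVec, Units.smul_def]
  ring

theorem Lift.eq_iff {a : Letter → Fin 2 → ℂ} {y : MProj six} (h : Lift (cv a) y) (i j : Letter) :
    y i = y j ↔ br (a i) (a j) = 0 := by
  obtain ⟨h0, h1⟩ := h i
  obtain ⟨h2, h3⟩ := h j
  rw [h1, h3]
  exact mk_conicVec_eq_iff h0 h2

/-- The coordinates of the point labelled `x`. -/
def Xv (x : Letter) : Fin 3 → Poly six := fun i => MvPolynomial.X ⟨x, i⟩

theorem isForm_Xv (x : Letter) (i : Fin 3) : IsForm (Xv x i) (Finsupp.single x 1) :=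
  IsForm.X (n := six) ⟨x, i⟩

theorem ev_Xv (w : ∀ x, Fin (six x) → ℂ) (x : Letter) (i : Fin 3) : ev w (Xv x i) = w x i :=
  ev_X w ⟨x, i⟩

theorem IsForm.bil {ι : Type} {n : ι → ℕ} {p q : Fin 3 → Poly n} {d e : ι →₀ ℕ}
    (hp : ∀ i, IsForm (p i) d) (hq : ∀ i, IsForm (q i) e) : IsForm (bil p q) (d + e) := by
  refine ((((hp 0).mul (hq 2)).sub ?_).add ((hp 2).mul (hq 0)))
  rw [mul_assoc]
  exact ((hp 1).mul (hq 1)).C_mul 2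

theorem ev_bil {ι : Type} {n : ι → ℕ} (w : ∀ i, Fin (n i) → ℂ) (p q : Fin 3 → Poly n) :
    ev w (bil p q) = bil (fun i => ev w (p i)) (fun i => ev w (q i)) := by
  have : ev w (2 : Poly n) = 2 := map_ofNat _ 2
  simp [bil, this]

open Classical in
/-- A form that does not vanish at `h`, and that vanishes where two points come together that are
distinct in `h`. -/
def sepForm (h : MProj six) : Poly six :=
  ∏ p : Letter × Letter, if h p.1 = h p.2 then 1 else bil (Xv p.1) (Xv p.2)

theorem exists_isForm_sepForm (h : MProj six) : ∃ d, IsForm (sepForm h) d := by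
  classical
  refine ⟨_, IsForm.prod (d := fun p => if h p.1 = h p.2 then 0 else
    Finsupp.single p.1 1 + Finsupp.single p.2 1) _ fun p _ => ?_⟩
  split_ifs
  · exact IsForm.C 1
  · exact IsForm.bil (isForm_Xv _) (isForm_Xv _)

theorem ev_sepForm_ne_zero_iff (h : MProj six) (a : Letter → Fin 2 → ℂ) :
    ev (cv a) (sepForm h) ≠ 0 ↔ ∀ i j, br (a i) (a j) = 0 → h i = h j := by
  classical
  have : ∀ x, (fun i => ev (cv a) (Xv x i)) = conicVec (a x) := fun x => funext fun i => ev_Xv _ _ _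
  rw [sepForm, map_prod, Finset.prod_ne_zero_iff]
  constructor
  · intro h1 i j h2
    by_contra h3
    have := h1 (i, j) (Finset.mem_univ _)
    simp_all [ev_bil, bil_conicVec]
  · rintro h1 ⟨i, j⟩ -
    have := h1 i j
    simp only
    split_ifs with h2
    · simp
    · simp_all [ev_bil, bil_conicVec]

theorem Lift.ev_sepForm_ne_zero {h : MProj six} {a : Letter → Fin 2 → ℂ} (ha : Lift (cv a) h) :
    ev (cv a) (sepForm h) ≠ 0 :=
  (ev_sepForm_ne_zero_iff h a).2 fun i j hij => (ha.eq_iff i j).2 hij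

theorem exists_polynomial_line (a g : Letter → Fin 2 → ℂ) (P : Poly six) :
    ∃ p : Polynomial ℂ, ∀ t, p.eval t = ev (cv fun x => (1 - t) • a x + t • g x) P := by
  let γ : Letter → Fin 2 → Polynomial ℂ := fun x i =>
    (1 - Polynomial.X) * Polynomial.C (a x i) + Polynomial.X * Polynomial.C (g x i)
  refine ⟨MvPolynomial.aeval (fun s : (Σ i, Fin (six i)) => conicVec (γ s.1) s.2) P, fun t => ?_⟩
  have : (Polynomial.aeval t).comp
      (MvPolynomial.aeval (fun s : (Σ i, Fin (six i)) => conicVec (γ s.1) s.2)) =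
      ev (cv fun x => (1 - t) • a x + t • g x) := by
    ext ⟨x, i⟩
    simp only [AlgHom.comp_apply, MvPolynomial.aeval_X, ev_X]
    change Fin 3 at i
    fin_cases i <;> simp [conicVec, cv, γ] <;> ring
  exact DFunLike.congr_fun this P

/-- A family of parametrized sextuples containing the line from `a` to `g` is irreducible. -/
theorem ev_eq_zero_of_mul {P Q : Poly six} {a g : Letter → Fin 2 → ℂ}
    (h : ∀ t : ℂ, ev (cv fun x => (1 - t) • a x + t • g x) Q ≠ 0 →
      ev (cv fun x => (1 - t) • a x + t • g x) P = 0) (hg : ev (cv g) Q ≠ 0) :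
    ev (cv a) P = 0 := by
  obtain ⟨p, hp⟩ := exists_polynomial_line a g P
  obtain ⟨q, hq⟩ := exists_polynomial_line a g Q
  have h1 : p * q = 0 := Polynomial.funext fun t => by
    rw [Polynomial.eval_mul, hp, hq, Polynomial.eval_zero, mul_eq_zero, or_iff_not_imp_right]
    exact h t
  have h2 : q ≠ 0 := by
    rintro rfl
    have := hq 1
    simp at this
    exact hg this.symm
  have h3 := (mul_eq_zero.1 h1).resolve_right h2
  have := hp 0
  simpa [h3] using this.symm

/-! ## Coincidences -/

/-- Equal letters, or one of the pairs `AB`, `EF`. -/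
def Paired (x y : Letter) : Prop :=
  x = y ∨ (x = .A ∧ y = .B) ∨ (x = .B ∧ y = .A) ∨ (x = .E ∧ y = .F) ∨ (x = .F ∧ y = .E)

instance : DecidableRel Paired := fun _ _ => by unfold Paired; infer_instance

theorem card_of_paired (c : Finset Letter) (hc : ∀ x ∈ c, ∀ y ∈ c, Paired x y) :
    c.card ≤ 2 ∧ (c.card = 2 → c = {.A, .B} ∨ c = {.E, .F}) := by
  revert c
  decide +kernel

theorem paired_of_theta {h : MProj six} (hθ : (theta h).parts =
    {{Letter.A, Letter.B}, {Letter.E, Letter.F}, {Letter.C}, {Letter.D}}) {x y : Letter}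
    (hxy : h x = h y) : Paired x y := by
  classical
  have h1 : (theta h).part x ∈ (theta h).parts := (theta h).part_mem.2 (Finset.mem_univ _)
  have h2 : x ∈ (theta h).part x := (theta h).mem_part (Finset.mem_univ _)
  have h3 : y ∈ (theta h).part x := by
    rw [theta, Finpartition.mem_part_ofSetoid_iff_rel]
    exact hxy
  rw [hθ] at h1
  revert h2 h3
  generalize (theta h).part x = c at h1
  revert x y c
  simp only [Finset.mem_insert, Finset.mem_singleton]
  rintro x y - c (rfl | rfl | rfl | rfl) <;> simp [Paired] <;> rintro (rfl | rfl) (rfl | rfl) <;> simp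

theorem card_of_mem_polydiagonal {y : MProj six} (hp : ∀ i j, y i = y j → Paired i j)
    {π : LetterPartition} (h : y ∈ polydiagonal π) {c : Finset Letter} (hc : c ∈ π.parts) :
    c.card ≤ 2 ∧ (c.card = 2 → c = {.A, .B} ∨ c = {.E, .F}) :=
  card_of_paired c fun i hi j hj => hp i j (h.2 c hc i hi j hj)

theorem notMem_polydiagonals {y : MProj six} (hp : ∀ i j, y i = y j → Paired i j)
    {t : Multiset ℕ} (ht : ∃ k ∈ t, 2 < k) : y ∉ polydiagonals t := by
  intro h
  obtain ⟨π, hπ, hy⟩ := Set.mem_iUnion₂.1 h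
  obtain ⟨k, hk, hk2⟩ := ht
  rw [← hπ] at hk
  obtain ⟨c, hc, rfl⟩ := Multiset.mem_map.1 hk
  exact absurd (card_of_mem_polydiagonal hp hy hc).1 (by omega)

theorem mem_Hcirc_of_paired {y : MProj six} (hy : y ∈ sextuples)
    (hp : ∀ i j, y i = y j → Paired i j) : y ∈ Hcirc := by
  refine ⟨hy, ?_⟩
  rintro (h | h)
  · exact notMem_polydiagonals hp ⟨3, by simp, by norm_num⟩ h
  · exact notMem_polydiagonals hp ⟨4, by simp, by norm_num⟩ h

/-- In a partition of type (2,2,2) the letter C has a partner, but C is paired only with itself. -/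
theorem notMem_Z_of_paired {y : MProj six} (hp : ∀ i j, y i = y j → Paired i j) : y ∉ Z := by
  rintro ⟨-, h⟩
  obtain ⟨π, hπ, hy⟩ := Set.mem_iUnion₂.1 h
  have h1 : π.part .C ∈ π.parts := π.part_mem.2 (Finset.mem_univ _)
  have h2 : Letter.C ∈ π.part .C := π.mem_part (Finset.mem_univ _)
  have h3 : (π.part .C).card ∈ partitionType π := Multiset.mem_map.2 ⟨_, h1, rfl⟩
  rw [hπ] at h3
  rcases (card_of_mem_polydiagonal hp hy h1).2 (by simpa using h3) with h4 | h4 <;>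
    rw [h4] at h2 <;> simp at h2

/-- The only admissible parts of size two are AB and EF, and type (2,2,1,1) needs two such parts;
type (3,1,1,1) needs a part that is too large. So near `h` the set `Y` has just one component. -/
theorem eq_of_mem_Y_of_paired {y : MProj six} (hp : ∀ i j, y i = y j → Paired i j) (hY : y ∈ Y) :
    y .A = y .B ∧ y .E = y .F := by
  rcases hY.2 with h | h
  · obtain ⟨π, hπ, hy⟩ := Set.mem_iUnion₂.1 h
    have h1 : (π.parts.filter fun c => 2 = c.card).card = 2 := by
      have := congrArg (Multiset.count 2) hπ
      rw [partitionType, Multiset.count_map] at this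
      exact this.trans (by decide)
    have h2 : (π.parts.filter fun c => 2 = c.card) ⊆ {{.A, .B}, {.E, .F}} := by
      intro c hc
      rw [Finset.mem_filter] at hc
      simpa using (card_of_mem_polydiagonal hp hy hc.1).2 hc.2.symm
    have h3 := Finset.eq_of_subset_of_card_le h2 (by rw [h1]; exact Finset.card_le_two)
    have h4 : ({.A, .B} : Finset Letter) ∈ π.parts :=
      (Finset.mem_filter.1 (h3.symm ▸ by simp : ({.A, .B} : Finset Letter) ∈
        π.parts.filter fun c => 2 = c.card)).1
    have h5 : ({.E, .F} : Finset Letter) ∈ π.parts :=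
      (Finset.mem_filter.1 (h3.symm ▸ by simp : ({.E, .F} : Finset Letter) ∈
        π.parts.filter fun c => 2 = c.card)).1
    exact ⟨hy.2 _ h4 _ (by simp) _ (by simp), hy.2 _ h5 _ (by simp) _ (by simp)⟩
  · exact absurd h (notMem_polydiagonals hp ⟨3, by simp, by norm_num⟩)

theorem mem_Y_of_eq {y : MProj six} (hy : y ∈ Hcirc) (hA : y .A = y .B) (hE : y .E = y .F) :
    y ∈ Y := by
  classical
  refine ⟨hy, Or.inl ?_⟩
  let c : Letter → Fin 4 := fun
    | .A => 0 | .B => 0 | .C => 1 | .D => 2 | .E => 3 | .F => 3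
  let π : LetterPartition := Finpartition.ofSetoid (Setoid.ker c)
  have hr : ∀ x x', x' ∈ π.part x ↔ c x = c x' := fun x x' =>
    Finpartition.mem_part_ofSetoid_iff_rel
  have hparts : π.parts = {{.A, .B}, {.E, .F}, {.C}, {.D}} := by
    have h1 : π.parts = Finset.univ.image π.part := by
      ext b
      constructor
      · intro hb
        obtain ⟨x, hx⟩ := π.nonempty_of_mem_parts hb
        exact Finset.mem_image.2 ⟨x, Finset.mem_univ _, π.part_eq_of_mem hb hx⟩
      · intro hb
        obtain ⟨x, hx, rfl⟩ := Finset.mem_image.1 hb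
        exact π.part_mem.2 hx
    have h2 : ∀ x, π.part x = Finset.univ.filter fun x' => c x = c x' := by
      intro x
      ext x'
      simp [hr]
    rw [h1, show π.part = fun x => Finset.univ.filter fun x' => c x = c x' from funext h2]
    decide +kernel
  refine Set.mem_iUnion₂.2 ⟨π, ?_, hy.1, ?_⟩
  · rw [partitionType, hparts]
    decide +kernel
  · rw [hparts]
    simp only [Finset.mem_insert, Finset.mem_singleton]
    rintro b (rfl | rfl | rfl | rfl) <;> simp [hA, hE]

/-- The sextuples of distinct points. -/
def distinctSextuples : Set (MProj six) :=
  {h ∈ sextuples | ∀ i j, h i = h j → i = j}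

theorem distinctSextuples_subset : distinctSextuples ⊆ Hcirc :=
  fun _ hy => mem_Hcirc_of_paired hy.1 fun i j hij => Or.inl (hy.2 i j hij)

/-- Parameters of a sextuple of distinct points. -/
def stdParam : Letter → Fin 2 → ℂ
  | .A => ![1, 0] | .B => ![1, 1] | .C => ![1, 2] | .D => ![1, 3] | .E => ![1, 4] | .F => ![1, 5]

theorem eq_of_br_stdParam {i j : Letter} (h : br (stdParam i) (stdParam j) = 0) : i = j := by
  cases i <;> cases j <;> 
    first | rfl | (exfalso; revert h; norm_num [br, stdParam])

theorem exists_lift_cv {a : Letter → Fin 2 → ℂ} (h : ∀ i j, br (a i) (a j) = 0 → Paired i j) :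
    ∃ y : MProj six, Lift (cv a) y := by
  refine exists_lift fun i h0 => ?_
  -- A zero parameter has zero bracket with everything, but no letter is paired with both C and D.
  have h1 : a i = 0 := conicVec_eq_zero h0
  have h2 := h i .C (by simp [br, h1])
  have h3 := h i .D (by simp [br, h1])
  revert h2 h3
  cases i <;> simp [Paired]

/-- A polynomial that vanishes on the sextuples of distinct points vanishes on all sextuples. -/
theorem ev_eq_zero_of_distinct {P : Poly six}
    (h : ∀ a y, Lift (cv a) y → y ∈ distinctSextuples → ev (cv a) P = 0) (a : Letter → Fin 2 → ℂ) :
    ev (cv a) P = 0 := by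
  obtain ⟨g, hg⟩ := exists_lift_cv (a := stdParam) fun i j hij => Or.inl (eq_of_br_stdParam hij)
  have hinj : ∀ i j, g i = g j → i = j := fun i j hij => eq_of_br_stdParam ((hg.eq_iff i j).1 hij)
  refine ev_eq_zero_of_mul (Q := sepForm g) (g := stdParam) (fun t ht => ?_) hg.ev_sepForm_ne_zero
  rw [ev_sepForm_ne_zero_iff] at ht
  obtain ⟨y, hy⟩ := exists_lift_cv fun i j hij => Or.inl (hinj i j (ht i j hij))
  exact h _ y hy ⟨hy.mem_sextuples, fun i j hij => hinj i j (ht i j ((hy.eq_iff i j).1 hij))⟩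

theorem Hcirc_subset_zariskiClosure : Hcirc ⊆ zariskiClosure distinctSextuples := by
  intro x hx G d hG h0
  obtain ⟨a, ha, -⟩ := exists_rep_eq_cv hx.1
  rw [val_eq_ev, ha]
  exact ev_eq_zero_of_distinct (fun b y hb hy => (hb.val_eq_zero hG).1 (h0 y hy)) a

end Pascal

namespace Pascal

open Matrix

/-! ## Determinants of points of the conic -/

/-- The triple product. -/
def det3 {R : Type*} [CommRing R] (p q r : Fin 3 → R) : R := p ⬝ᵥ (q ⨯₃ r)

theorem det3_eq {R : Type*} [CommRing R] (p q r : Fin 3 → R) :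
    det3 p q r = p 0 * (q 1 * r 2 - q 2 * r 1) + p 1 * (q 2 * r 0 - q 0 * r 2) +
      p 2 * (q 0 * r 1 - q 1 * r 0) := by
  simp only [det3, cross_apply, dotProduct, Fin.sum_univ_three]
  simp

/-- A Vandermonde determinant. Where z differs from x and y, `dt x y z` is thus an equation of the
diagonal x = y, and it vanishes to first order. -/
theorem det3_conicVec (a b c : Fin 2 → ℂ) :
    det3 (conicVec a) (conicVec b) (conicVec c) = br a b * br a c * br b c := by
  simp [det3_eq, conicVec, br]
  ring

/-- The join of AD ∩ CF and BD ∩ CE passes through BD ∩ CE, so it is a combination of the lines CE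
and BD. This holds for any six vectors; the coefficients contain det(A,B,D) and det(C,E,F), the
factors that vanish when A = B and when E = F. -/
theorem cross_cross_cross {R : Type*} [CommRing R] (A B C D E F : Fin 3 → R) :
    ((A ⨯₃ D) ⨯₃ (C ⨯₃ F)) ⨯₃ ((B ⨯₃ D) ⨯₃ (C ⨯₃ E)) =
      (det3 A B D * det3 C F D) • (C ⨯₃ E) + (det3 C E F * det3 A C D) • (B ⨯₃ D) := by
  funext i
  fin_cases i <;> simp [det3_eq, cross_apply] <;> ring

/-- Pascal's theorem. -/
theorem pascal_conicVec (a b c d e f : Fin 2 → ℂ) :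
    ((det3 (conicVec a) (conicVec b) (conicVec d) * det3 (conicVec c) (conicVec f) (conicVec d)) •
        (conicVec c ⨯₃ conicVec e) +
      (det3 (conicVec c) (conicVec e) (conicVec f) * det3 (conicVec a) (conicVec c) (conicVec d)) •
        (conicVec b ⨯₃ conicVec d)) ⬝ᵥ
      ((conicVec a ⨯₃ conicVec e) ⨯₃ (conicVec b ⨯₃ conicVec f)) = 0 := by
  -- The lines CE and AE share E, and BD and BF share B, so each triple product of lines splits into
  -- two determinants of points. On the conic the resulting products of brackets cancel.
  have h1 : ∀ p q r s : Fin 3 → ℂ, ∀ t, (p ⨯₃ q) ⬝ᵥ ((r ⨯₃ q) ⨯₃ (s ⨯₃ t)) =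
      det3 p q r * det3 q t s := by
    intro p q r s t
    simp [det3_eq, cross_apply]
    ring
  have h2 : ∀ p q r s : Fin 3 → ℂ, ∀ t, (p ⨯₃ q) ⬝ᵥ ((r ⨯₃ s) ⨯₃ (p ⨯₃ t)) =
      det3 p q t * det3 p s r := by
    intro p q r s t
    simp [det3_eq, cross_apply]
    ring
  rw [add_dotProduct, smul_dotProduct, smul_dotProduct, h1, h2]
  simp only [det3_conicVec, smul_eq_mul]
  simp only [br]
  ring

section

variable {ι : Type} {n : ι → ℕ}

theorem IsForm.cross {p q : Fin 3 → Poly n} {d e : ι →₀ ℕ} (hp : ∀ i, IsForm (p i) d)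
    (hq : ∀ i, IsForm (q i) e) (i : Fin 3) : IsForm ((p ⨯₃ q) i) (d + e) := by
  have h : ∀ j k, IsForm (p j * q k - p k * q j) (d + e) := fun j k =>
    ((hp j).mul (hq k)).sub ((hp k).mul (hq j))
  fin_cases i <;> simpa [cross_apply] using h _ _

theorem IsForm.dotProduct {k : ℕ} {p q : Fin k → Poly n} {d e : ι →₀ ℕ}
    (hp : ∀ i, IsForm (p i) d) (hq : ∀ i, IsForm (q i) e) : IsForm (p ⬝ᵥ q) (d + e) :=
  IsForm.sum _ fun i _ => (hp i).mul (hq i)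

theorem IsForm.det3 {p q r : Fin 3 → Poly n} {d e f : ι →₀ ℕ} (hp : ∀ i, IsForm (p i) d)
    (hq : ∀ i, IsForm (q i) e) (hr : ∀ i, IsForm (r i) f) :
    IsForm (Pascal.det3 p q r) (d + (e + f)) :=
  IsForm.dotProduct hp (IsForm.cross hq hr)

theorem ev_cross (w : ∀ i, Fin (n i) → ℂ) (p q : Fin 3 → Poly n) :
    (fun i => ev w ((p ⨯₃ q) i)) = (fun i => ev w (p i)) ⨯₃ (fun i => ev w (q i)) := by
  funext i
  fin_cases i <;> simp [cross_apply]

theorem ev_dotProduct (w : ∀ i, Fin (n i) → ℂ) {k : ℕ} (p q : Fin k → Poly n) :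
    ev w (p ⬝ᵥ q) = (fun i => ev w (p i)) ⬝ᵥ (fun i => ev w (q i)) := by
  simp [dotProduct]

theorem ev_det3 (w : ∀ i, Fin (n i) → ℂ) (p q r : Fin 3 → Poly n) :
    ev w (det3 p q r) =
      det3 (fun i => ev w (p i)) (fun i => ev w (q i)) (fun i => ev w (r i)) := by
  rw [det3, ev_dotProduct, ev_cross, det3]

end

theorem ev_cv_Xv (a : Letter → Fin 2 → ℂ) (x : Letter) :
    (fun i => ev (cv a) (Xv x i)) = conicVec (a x) :=
  funext fun _ => ev_Xv _ _ _

/-! ## The ideal of a diagonal -/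

/-- The triple product of three of the points of a sextuple. -/
def dt (x y z : Letter) : Poly six := det3 (Xv x) (Xv y) (Xv z)

/-- The multidegree of `dt`. -/
abbrev dtDeg (x y z : Letter) : Letter →₀ ℕ :=
  Finsupp.single x 1 + (Finsupp.single y 1 + Finsupp.single z 1)

theorem isForm_dt (x y z : Letter) : IsForm (dt x y z) (dtDeg x y z) :=
  IsForm.det3 (isForm_Xv x) (isForm_Xv y) (isForm_Xv z)

theorem ev_dt (a : Letter → Fin 2 → ℂ) (x y z : Letter) :
    ev (cv a) (dt x y z) = br (a x) (a y) * br (a x) (a z) * br (a y) (a z) := by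
  rw [dt, ev_det3, ev_cv_Xv, ev_cv_Xv, ev_cv_Xv, det3_conicVec]

/-- Coefficient of `y` in the relation `ev_relation`. -/
def lam (x y z : Letter) : Poly six := bil (Xv x) (Xv z) ^ 2 * bil (Xv y) (Xv z)

/-- Coefficient of `x` in the relation `ev_relation`. -/
def mu (x y z : Letter) : Poly six := bil (Xv x) (Xv z) * bil (Xv y) (Xv z) ^ 2

/-- Cofactor of `dt x y z` in the relation `ev_relation`. -/
def cof (x y z : Letter) (i : Fin 3) : Poly six :=
  bil (Xv y) (Xv z) * ![2 * (Xv x ⨯₃ Xv z) 2, -(Xv x ⨯₃ Xv z) 1, 2 * (Xv x ⨯₃ Xv z) 0] i +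
    dt x y z * Xv z i

/-- Multidegree of the relation `ev_relation`. -/
abbrev relDeg (x y z : Letter) : Letter →₀ ℕ :=
  2 • Finsupp.single x 1 + 2 • Finsupp.single y 1 + 3 • Finsupp.single z 1

theorem isForm_lam (x y z : Letter) :
    IsForm (lam x y z) (dtDeg x y z + (Finsupp.single x 1 + 2 • Finsupp.single z 1)) := by
  have := ((IsForm.bil (isForm_Xv x) (isForm_Xv z)).pow 2).mul
    (IsForm.bil (isForm_Xv y) (isForm_Xv z))
  rw [lam]
  convert this using 1
  module

theorem isForm_mu_mul (x y z : Letter) (i : Fin 3) :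
    IsForm (mu x y z * Xv x i) (relDeg x y z) := by
  have := ((IsForm.bil (isForm_Xv x) (isForm_Xv z)).mul
    ((IsForm.bil (isForm_Xv y) (isForm_Xv z)).pow 2)).mul (isForm_Xv x i)
  rw [mu]
  convert this using 1
  module

theorem isForm_dt_mul_cof (x y z : Letter) (i : Fin 3) :
    IsForm (dt x y z * cof x y z i) (relDeg x y z) := by
  have h1 := IsForm.cross (isForm_Xv x) (isForm_Xv z)
  have h2 : IsForm (![2 * (Xv x ⨯₃ Xv z) 2, -(Xv x ⨯₃ Xv z) 1, 2 * (Xv x ⨯₃ Xv z) 0] i)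
      (Finsupp.single x 1 + Finsupp.single z 1) := by
    fin_cases i
    · exact (h1 2).C_mul 2
    · exact (h1 1).neg
    · exact (h1 0).C_mul 2
  have h3 := (IsForm.bil (isForm_Xv y) (isForm_Xv z)).mul h2
  have h4 := (isForm_dt x y z).mul (isForm_Xv z i)
  have h5 : dtDeg x y z + Finsupp.single z 1 = Finsupp.single y 1 + Finsupp.single z 1 +
      (Finsupp.single x 1 + Finsupp.single z 1) := by
    rw [dtDeg]
    module
  rw [h5] at h4
  have h6 := (isForm_dt x y z).mul (h3.add h4)
  rw [cof]
  convert h6 using 1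
  rw [dtDeg]
  module

/-- On the conic the point `y` is a combination of `x` and of a multiple of `dt x y z`. -/
theorem ev_relation (a : Letter → Fin 2 → ℂ) (x y z : Letter) (i : Fin 3) :
    ev (cv a) (mu x y z * Xv x i + dt x y z * cof x y z i) = ev (cv a) (lam x y z) * cv a y i := by
  -- The source is the Plücker relation br(x,z) · y = br(y,z) · x + br(x,y) · z between parameters.
  -- Squaring it and multiplying by br(x,z)² br(y,z)² makes every coefficient a polynomial in the
  -- points and turns br(x,y) into `dt x y z`.
  have h2 : ev (cv a) (2 : Poly six) = 2 := map_ofNat _ 2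
  have hX : ∀ x i, ev (cv a) (Xv x i) = conicVec (a x) i := fun x i => ev_Xv _ _ _
  simp only [lam, mu, cof, dt, map_add, map_mul, map_pow, ev_bil, ev_det3, bil_conicVec,
    det3_conicVec, cv, hX]
  fin_cases i <;> simp [cross_apply, conicVec, h2, hX, br] <;> ring

theorem ev_one_smul_apply {k : ℕ} (w : ∀ x, Fin (six x) → ℂ) (v : Fin k → ℂ) (i : Fin k) :
    (ev w (1 : Poly six) • v) i = v i := by
  rw [map_one, one_smul]

theorem ev_lam_ne_zero {a : Letter → Fin 2 → ℂ} {x y z : Letter} (h1 : br (a x) (a z) ≠ 0)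
    (h2 : br (a y) (a z) ≠ 0) : ev (cv a) (lam x y z) ≠ 0 := by
  simp only [lam, map_mul, map_pow, ev_bil, ev_cv_Xv, bil_conicVec]
  positivity

/-- On the conic, and up to units, B is A plus a multiple of `dt .A .B .D`, and F is E plus a
multiple of `dt .E .F .C` (`ev_relation`). Substituting this into `G j` and reducing modulo the two
determinants leaves the value of `G j` at a sextuple with B = A and F = E, which is zero. -/
theorem exists_cofactors {N : ℕ} {g : Letter →₀ ℕ} {G : Fin N → Poly six}
    (hG : ∀ j, IsForm (G j) g)
    (h0 : ∀ j a, a .A = a .B → a .E = a .F → ev (cv a) (G j) = 0) :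
    ∃ (U : Poly six) (u : Letter →₀ ℕ) (P Q : Fin N → Poly six) (p q : Letter →₀ ℕ),
      IsForm U u ∧
      (∀ a, br (a .A) (a .D) ≠ 0 → br (a .B) (a .D) ≠ 0 → br (a .E) (a .C) ≠ 0 →
        br (a .F) (a .C) ≠ 0 → ev (cv a) U ≠ 0) ∧
      (∀ j, IsForm (P j) p) ∧ (∀ j, IsForm (Q j) q) ∧
      p + dtDeg .A .B .D = q + dtDeg .E .F .C ∧
      ∀ a j, ev (cv a) U * ev (cv a) (G j) =
        ev (cv a) (P j) * ev (cv a) (dt .A .B .D) + ev (cv a) (Q j) * ev (cv a) (dt .E .F .C) := by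
  -- `σ₁` replaces B and F by expressions which on the conic are unit multiples of B and F; `σ₀`
  -- keeps only their leading terms, which are multiples of A and E. The two agree modulo the
  -- determinants.
  let σ₀ : (Σ x, Fin (six x)) → Poly six := fun
    | ⟨.B, i⟩ => mu .A .B .D * Xv .A i
    | ⟨.F, i⟩ => mu .E .F .C * Xv .E i
    | ⟨.A, i⟩ => Xv .A i | ⟨.C, i⟩ => Xv .C i | ⟨.D, i⟩ => Xv .D i | ⟨.E, i⟩ => Xv .E i
  let σ₁ : (Σ x, Fin (six x)) → Poly six := fun
    | ⟨.B, i⟩ => mu .A .B .D * Xv .A i + dt .A .B .D * cof .A .B .D i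
    | ⟨.F, i⟩ => mu .E .F .C * Xv .E i + dt .E .F .C * cof .E .F .C i
    | ⟨.A, i⟩ => Xv .A i | ⟨.C, i⟩ => Xv .C i | ⟨.D, i⟩ => Xv .D i | ⟨.E, i⟩ => Xv .E i
  let s : Letter → Letter →₀ ℕ := fun
    | .B => relDeg .A .B .D | .F => relDeg .E .F .C
    | .A => Finsupp.single .A 1 | .C => Finsupp.single .C 1
    | .D => Finsupp.single .D 1 | .E => Finsupp.single .E 1
  let c : Letter → Poly six := fun
    | .B => lam .A .B .D | .F => lam .E .F .C
    | .A => 1 | .C => 1 | .D => 1 | .E => 1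
  let c₀ : Letter → Poly six := fun
    | .B => mu .A .B .D | .F => mu .E .F .C
    | .A => 1 | .C => 1 | .D => 1 | .E => 1
  let sc : Letter → Letter →₀ ℕ := fun
    | .B => dtDeg .A .B .D + (Finsupp.single .A 1 + 2 • Finsupp.single .D 1)
    | .F => dtDeg .E .F .C + (Finsupp.single .E 1 + 2 • Finsupp.single .C 1)
    | .A => 0 | .C => 0 | .D => 0 | .E => 0
  have hc : ∀ x, IsForm (c x) (sc x) := by
    rintro (_ | _ | _ | _ | _ | _)
    · exact IsForm.C 1
    · exact isForm_lam .A .B .D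
    · exact IsForm.C 1
    · exact IsForm.C 1
    · exact IsForm.C 1
    · exact isForm_lam .E .F .C
  have hσ₀ : ∀ v, IsForm (σ₀ v) (s v.1) := by
    rintro ⟨_ | _ | _ | _ | _ | _, i⟩
    · exact isForm_Xv .A i
    · exact isForm_mu_mul .A .B .D i
    · exact isForm_Xv .C i
    · exact isForm_Xv .D i
    · exact isForm_Xv .E i
    · exact isForm_mu_mul .E .F .C i
  have hσ₁ : ∀ v, IsForm (σ₁ v) (s v.1) := by
    rintro ⟨_ | _ | _ | _ | _ | _, i⟩
    · exact isForm_Xv .A i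
    · exact (isForm_mu_mul .A .B .D i).add (isForm_dt_mul_cof .A .B .D i)
    · exact isForm_Xv .C i
    · exact isForm_Xv .D i
    · exact isForm_Xv .E i
    · exact (isForm_mu_mul .E .F .C i).add (isForm_dt_mul_cof .E .F .C i)
  have hmem : ∀ v, σ₁ v - σ₀ v ∈ Ideal.span {dt .A .B .D, dt .E .F .C} := by
    rintro ⟨_ | _ | _ | _ | _ | _, i⟩
    all_goals simp only [σ₁, σ₀, sub_self, add_sub_cancel_left, zero_mem]
    all_goals exact Ideal.mul_mem_right _ _ (Ideal.subset_span (by simp))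
  have hev₁ : ∀ a P, IsForm P g → ev (cv a) (MvPolynomial.aeval σ₁ P) =
      ev (cv a) (∏ x, c x ^ g x) * ev (cv a) P := by
    intro a P hP
    have h1 : (fun x i => ev (cv a) (σ₁ ⟨x, i⟩)) = fun x => ev (cv a) (c x) • cv a x := by
      funext x i
      cases x with
      | B => exact ev_relation a .A .B .D i
      | F => exact ev_relation a .E .F .C i
      | A | C | D | E => exact (ev_Xv _ _ i).trans (ev_one_smul_apply _ _ i).symm
    rw [ev_aeval, h1, hP.ev_smul, Finsupp.prod_fintype _ _ fun _ => pow_zero _, map_prod]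
    simp only [map_pow]
  have hev₀ : ∀ a j, ev (cv a) (MvPolynomial.aeval σ₀ (G j)) = 0 := by
    intro a j
    let b : Letter → Fin 2 → ℂ := fun
      | .B => a .A | .F => a .E | .A => a .A | .C => a .C | .D => a .D | .E => a .E
    have h1 : (fun x i => ev (cv a) (σ₀ ⟨x, i⟩)) = fun x => ev (cv a) (c₀ x) • cv b x := by
      funext x i
      cases x with
      | B => exact (map_mul _ _ _).trans (congrArg _ (ev_Xv _ .A i))
      | F => exact (map_mul _ _ _).trans (congrArg _ (ev_Xv _ .E i))
      | A | C | D | E => exact (ev_Xv _ _ i).trans (ev_one_smul_apply _ _ i).symm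
    rw [ev_aeval, h1, (hG j).ev_smul, h0 j b rfl rfl, mul_zero]
  let D : Letter →₀ ℕ := Finsupp.linearCombination ℕ s g
  let H : Fin N → Poly six := fun j => MvPolynomial.aeval σ₁ (G j) - MvPolynomial.aeval σ₀ (G j)
  have hH : ∀ j, IsForm (H j) D := fun j =>
    (IsForm.aeval hσ₁ (hG j)).sub (IsForm.aeval hσ₀ (hG j))
  let e : Letter →₀ ℕ := Finsupp.single .A 1 + 2 • Finsupp.single .D 1
  let e' : Letter →₀ ℕ := Finsupp.single .E 1 + 2 • Finsupp.single .C 1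
  let p : Letter →₀ ℕ := e + (dtDeg .E .F .C + e') + D
  let q : Letter →₀ ℕ := dtDeg .A .B .D + e + e' + D
  have hpq : p + dtDeg .A .B .D = q + dtDeg .E .F .C := by
    simp only [p, q]
    abel
  -- The factors `lam` bring both determinant degrees into the multidegree, so that the degrees `p`
  -- and `q` of the cofactors can be written without subtraction.
  have key : ∀ j, ∃ P Q : Poly six, IsForm P p ∧ IsForm Q q ∧
      lam .A .B .D * lam .E .F .C * H j = P * dt .A .B .D + Q * dt .E .F .C := by
    intro j
    refine exists_isForm_of_mem_span_pair (isForm_dt _ _ _) (isForm_dt _ _ _) ?_ hpq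
      (Ideal.mul_mem_left _ _ (aeval_sub_aeval_mem hmem (G j)))
    convert ((isForm_lam .A .B .D).mul (isForm_lam .E .F .C)).mul (hH j) using 1
    simp only [p, e, e']
    abel
  choose P Q hP hQ hPQ using key
  refine ⟨lam .A .B .D * lam .E .F .C * ∏ x, c x ^ g x, _, P, Q, p, q,
    ((isForm_lam .A .B .D).mul (isForm_lam .E .F .C)).mul
      (IsForm.prod _ fun x _ => (hc x).pow _), ?_, hP, hQ, hpq, fun a j => ?_⟩
  · intro a h1 h2 h3 h4
    have hl₁ := ev_lam_ne_zero (a := a) (x := .A) (y := .B) (z := .D) h1 h2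
    have hl₂ := ev_lam_ne_zero (a := a) (x := .E) (y := .F) (z := .C) h3 h4
    rw [map_mul, map_mul, map_prod]
    refine mul_ne_zero (mul_ne_zero hl₁ hl₂) (Finset.prod_ne_zero_iff.2 fun x _ => ?_)
    rw [map_pow]
    refine pow_ne_zero _ ?_
    cases x with
    | B => exact hl₁
    | F => exact hl₂
    | A | C | D | E => exact (map_one (ev (cv a))).trans_ne one_ne_zero
  · have h2 : ev (cv a) (H j) = ev (cv a) (∏ x, c x ^ g x) * ev (cv a) (G j) := by
      rw [show H j = _ - _ from rfl, map_sub, hev₀, sub_zero, hev₁ a _ (hG j)]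
    rw [map_mul (ev (cv a)) (lam .A .B .D * lam .E .F .C), mul_assoc, ← h2, ← map_mul, hPQ,
      map_add, map_mul, map_mul]

end Pascal

namespace Pascal

open Matrix

/-! ## The blow-ups near a sextuple with the coincidences `AB` and `EF` -/

/-- A sextuple `h` with parameters `a₀`, with exactly the coincidences `AB` and `EF`, and generators
of the ideals of the centres of the two blow-ups. -/
structure Setting {N₁ N₂ : ℕ} (F₁ : Fin N₁ → Poly six) (F₂ : Fin N₂ → Poly (ext six N₁))
    (h : MProj six) (a₀ : Letter → Fin 2 → ℂ) : Prop where
  gen₁ : Generates F₁ Hcirc Z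
  gen₂ : Generates F₂ (blowup Hcirc F₁) (Y' F₁)
  rep : (fun x => (h x).rep) = cv a₀
  paired : ∀ i j, h i = h j → Paired i j
  eq_AB : a₀ .A = a₀ .B
  eq_EF : a₀ .E = a₀ .F

namespace Setting

variable {N₁ N₂ : ℕ} {F₁ : Fin N₁ → Poly six} {F₂ : Fin N₂ → Poly (ext six N₁)}
  {h : MProj six} {a₀ : Letter → Fin 2 → ℂ}

theorem lift (S : Setting F₁ F₂ h a₀) : Lift (cv a₀) h := S.rep ▸ lift_rep h

theorem val_eq (S : Setting F₁ F₂ h a₀) (G : Poly six) : val h G = ev (cv a₀) G := by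
  rw [val_eq_ev, S.rep]

theorem br_ne_zero (S : Setting F₁ F₂ h a₀) {i j : Letter} (hij : ¬ Paired i j) :
    br (a₀ i) (a₀ j) ≠ 0 :=
  fun h0 => hij (S.paired i j ((S.lift.eq_iff i j).2 h0))

theorem paired_of_sepForm (S : Setting F₁ F₂ h a₀) {b : Letter → Fin 2 → ℂ} {y : MProj six}
    (hb : Lift (cv b) y) (h0 : ev (cv b) (sepForm h) ≠ 0) (i j : Letter) (hij : y i = y j) :
    Paired i j :=
  S.paired i j ((ev_sepForm_ne_zero_iff h b).1 h0 i j ((hb.eq_iff i j).1 hij))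

theorem paired_of_val_sepForm (S : Setting F₁ F₂ h a₀) {y : MProj six} (hy : y ∈ sextuples)
    (h0 : val y (sepForm h) ≠ 0) (i j : Letter) (hij : y i = y j) : Paired i j := by
  obtain ⟨b, hb, -⟩ := exists_rep_eq_cv hy
  rw [val_eq_ev, hb] at h0
  exact S.paired_of_sepForm (hb ▸ lift_rep y) h0 i j hij

theorem mem_Hcirc (S : Setting F₁ F₂ h a₀) : h ∈ Hcirc :=
  mem_Hcirc_of_paired S.lift.mem_sextuples S.paired

/-- `sepForm h` vanishes on `Z` but not at `h`. Being locally a combination of the `F₁ k`, it forces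
one of them to be nonzero at `h`, so the first blow-up is a graph there. -/
theorem exists_F₁_ne_zero (S : Setting F₁ F₂ h a₀) : ∃ k, ev (cv a₀) (F₁ k) ≠ 0 := by
  obtain ⟨e, he⟩ := exists_isForm_sepForm h
  obtain ⟨U, a, C, -, hUx, hrel⟩ := S.gen₁.exists_relation S.mem_Hcirc he fun z hz => by
    by_contra h0
    exact notMem_Z_of_paired (S.paired_of_val_sepForm hz.1.1 h0) hz
  by_contra! hF
  have h1 := hrel h S.mem_Hcirc _ S.lift
  simp only [hF, mul_zero, Finset.sum_const_zero] at h1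
  rw [S.val_eq] at hUx
  exact mul_ne_zero hUx S.lift.ev_sepForm_ne_zero h1

theorem exists_lift_gr (S : Setting F₁ F₂ h a₀) {b : Letter → Fin 2 → ℂ} {k : Fin N₁}
    (h0 : ev (cv b) (sepForm h) ≠ 0) (hk : ev (cv b) (F₁ k) ≠ 0) :
    ∃ x ∈ graph Hcirc F₁, Lift (gr F₁ (cv b)) x ∧ Lift (cv b) (base x) ∧
      ∀ i j, base x i = base x j → Paired i j := by
  obtain ⟨d, hd, -⟩ := id S.gen₁
  obtain ⟨y, hy⟩ := exists_lift_cv fun i j hij =>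
    S.paired i j ((ev_sepForm_ne_zero_iff h b).1 h0 i j hij)
  obtain ⟨x, hx⟩ := exists_lift (w := gr F₁ (cv b)) (by
    rintro (_ | i)
    · exact fun h1 => hk (congrFun h1 k)
    · exact (hy i).1)
  have hb : Lift (cv b) (base x) := hx.base
  have hp := S.paired_of_sepForm hb h0
  exact ⟨x, (mem_graph_iff hd hb).2 ⟨mem_Hcirc_of_paired hb.mem_sextuples hp, hx⟩, hx, hb, hp⟩

/-- Points of the first graph over the diagonal and close to `h` belong to `Y'`, where the `F₂ j`
vanish. The segment from `a` to `a₀` stays in the diagonal, so the vanishing spreads to the whole of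
it. -/
theorem ev_res_F₂_eq_zero (S : Setting F₁ F₂ h a₀) (j : Fin N₂) (a : Letter → Fin 2 → ℂ)
    (hA : a .A = a .B) (hE : a .E = a .F) : ev (cv a) (res F₁ (F₂ j)) = 0 := by
  obtain ⟨k, hk⟩ := S.exists_F₁_ne_zero
  refine ev_eq_zero_of_mul (Q := sepForm h * F₁ k) (g := a₀) (fun t ht => ?_) ?_
  · rw [map_mul] at ht
    obtain ⟨x, hx, hxl, hb, hp⟩ := S.exists_lift_gr (left_ne_zero_of_mul ht)
      (right_ne_zero_of_mul ht)
    obtain ⟨d, hd, hd0, -⟩ := S.gen₂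
    rw [ev_res]
    refine (hxl.val_eq_zero (hd j)).1 (hd0 j x ⟨graph_subset_blowup _ _ hx, ?_⟩)
    refine subset_zariskiClosure _ ⟨graph_subset_blowup _ _ hx,
      mem_Y_of_eq hx.1 ((hb.eq_iff _ _).2 ?_) ((hb.eq_iff _ _).2 ?_), notMem_Z_of_paired hp⟩
    · simp only [hA, S.eq_AB, br]
      ring
    · simp only [hE, S.eq_EF, br]
      ring
  · rw [map_mul]
    exact mul_ne_zero S.lift.ev_sepForm_ne_zero hk

/-- A form that vanishes on the diagonal `AB · EF` lies locally in the ideal of the `F₂ j`. -/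
theorem exists_relation_F₂ (S : Setting F₁ F₂ h a₀) {α : Poly six} {d : Letter →₀ ℕ}
    (hα : IsForm α d)
    (h0 : ∀ a, br (a .A) (a .B) = 0 → br (a .E) (a .F) = 0 → ev (cv a) α = 0) :
    ∃ (V : Poly six) (B : Fin N₂ → Poly six), ev (cv a₀) V ≠ 0 ∧
      ∀ a, ev (cv a) V * ev (cv a) α = ∑ k, ev (cv a) (B k) * ev (cv a) (res F₁ (F₂ k)) := by
  obtain ⟨k, hk⟩ := S.exists_F₁_ne_zero
  obtain ⟨e, he⟩ := exists_isForm_sepForm h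
  obtain ⟨x, hx, hxl, hb, -⟩ := S.exists_lift_gr S.lift.ev_sepForm_ne_zero hk
  -- The form `α` need not vanish on the other components of `Y`; the factor `sepForm h` does, and
  -- it is a unit at `h`.
  obtain ⟨V, v, B, hV, hVx, hrel⟩ := S.gen₂.exists_relation (graph_subset_blowup _ _ hx)
    ((hα.mul he).emb N₁) (by
      rintro z ⟨-, hz⟩
      refine hz _ _ ((hα.mul he).emb N₁) ?_
      rintro y ⟨hy, hyY, -⟩
      rw [val_emb, val_mul]
      by_contra hne
      have hp := S.paired_of_val_sepForm hy.1.1 (right_ne_zero_of_mul hne)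
      obtain ⟨hAB, hEF⟩ := eq_of_mem_Y_of_paired hp hyY
      obtain ⟨c, hc, -⟩ := exists_rep_eq_cv hy.1.1
      have hcl : Lift (cv c) (base y) := hc ▸ lift_rep (base y)
      refine left_ne_zero_of_mul hne ?_
      rw [val_eq_ev, hc]
      exact h0 c ((hcl.eq_iff _ _).1 hAB) ((hcl.eq_iff _ _).1 hEF))
  refine ⟨res F₁ V * sepForm h, fun k => res F₁ (B k), ?_, fun a => ?_⟩
  · rw [map_mul, ev_res]
    exact mul_ne_zero (fun h1 => hVx ((hxl.val_eq_zero hV).2 h1)) S.lift.ev_sepForm_ne_zero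
  · rw [← sub_eq_zero]
    -- The relation is known only where the first graph is defined and no new coincidences occur;
    -- irreducibility of the space of parameters extends it to all `a`.
    have := ev_eq_zero_of_mul (a := a) (g := a₀) (Q := sepForm h * F₁ k)
      (P := res F₁ V * sepForm h * α - ∑ k, res F₁ (B k) * res F₁ (F₂ k)) (fun t ht => ?_) ?_
    · simpa using this
    · rw [map_mul] at ht
      obtain ⟨y, hy, hyl, -⟩ := S.exists_lift_gr (left_ne_zero_of_mul ht) (right_ne_zero_of_mul ht)
      have h1 := hrel y (graph_subset_blowup _ _ hy) _ hyl
      rw [gr, ev_emb, ← gr, map_mul] at h1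
      simp only [map_sub, map_mul, map_sum, ev_res, sub_eq_zero]
      rw [← h1]
      ring
    · rw [map_mul]
      exact mul_ne_zero S.lift.ev_sepForm_ne_zero hk

end Setting

/-! ### Local equations of the second centre -/

/-- Local equations: up to a unit at `a₀` the forms `G j` are combinations of the equations of the
diagonals `AB` and `EF`, with a matrix of coefficients that has rank two at `a₀`. -/
structure LocalEquations {N : ℕ} (G : Fin N → Poly six) (a₀ : Letter → Fin 2 → ℂ) where
  U : Poly six
  u : Letter →₀ ℕ
  P : Fin N → Poly six
  Q : Fin N → Poly six
  p : Letter →₀ ℕ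
  q : Letter →₀ ℕ
  isForm_U : IsForm U u
  ev_U_ne_zero : ev (cv a₀) U ≠ 0
  isForm_P : ∀ j, IsForm (P j) p
  isForm_Q : ∀ j, IsForm (Q j) q
  degree_eq : p + dtDeg .A .B .D = q + dtDeg .E .F .C
  relation : ∀ a j, ev (cv a) U * ev (cv a) (G j) =
    ev (cv a) (P j) * ev (cv a) (dt .A .B .D) + ev (cv a) (Q j) * ev (cv a) (dt .E .F .C)
  i : Fin N
  j : Fin N
  minor_ne_zero :
    ev (cv a₀) (P i) * ev (cv a₀) (Q j) - ev (cv a₀) (P j) * ev (cv a₀) (Q i) ≠ 0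

theorem ev_dt_ABD_eq_zero {a : Letter → Fin 2 → ℂ} (h : br (a .A) (a .B) = 0) :
    ev (cv a) (dt .A .B .D) = 0 := by
  rw [ev_dt, h, zero_mul, zero_mul]

theorem ev_dt_EFC_eq_zero {a : Letter → Fin 2 → ℂ} (h : br (a .E) (a .F) = 0) :
    ev (cv a) (dt .E .F .C) = 0 := by
  rw [ev_dt, h, zero_mul, zero_mul]

theorem br_self (a : Fin 2 → ℂ) : br a a = 0 := by
  simp only [br]
  ring

/-- If a combination of the equations of the diagonals `AB` and `EF` vanishes identically, its
coefficients vanish on their intersection. -/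
theorem coefficients_eq_zero {a₀ : Letter → Fin 2 → ℂ} (hAB : a₀ .A = a₀ .B) (hEF : a₀ .E = a₀ .F)
    (hAC : br (a₀ .A) (a₀ .C) ≠ 0) (hAD : br (a₀ .A) (a₀ .D) ≠ 0) (hCD : br (a₀ .C) (a₀ .D) ≠ 0)
    (hEC : br (a₀ .E) (a₀ .C) ≠ 0) (hED : br (a₀ .E) (a₀ .D) ≠ 0) {R T : Poly six}
    (h : ∀ a, ev (cv a) R * ev (cv a) (dt .A .B .D) + ev (cv a) T * ev (cv a) (dt .E .F .C) = 0) :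
    ev (cv a₀) R = 0 ∧ ev (cv a₀) T = 0 := by
  constructor
  -- Moving B towards C keeps E = F, so only the term with `R` survives, while A and B separate and
  -- `dt .A .B .D` is not identically zero. For `T`, F moves towards D in the same way.
  · refine ev_eq_zero_of_mul (Q := dt .A .B .D) (g := Function.update a₀ .B (a₀ .C))
      (fun t ht => ?_) ?_
    · have h1 := h fun x => (1 - t) • a₀ x + t • Function.update a₀ .B (a₀ .C) x
      rw [ev_dt_EFC_eq_zero (by simp [hEF, br_self]), mul_zero, add_zero] at h1
      exact (mul_eq_zero.1 h1).resolve_right ht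
    · rw [ev_dt]
      simpa using ⟨⟨hAC, hAD⟩, hCD⟩
  · refine ev_eq_zero_of_mul (Q := dt .E .F .C) (g := Function.update a₀ .F (a₀ .D))
      (fun t ht => ?_) ?_
    · have h1 := h fun x => (1 - t) • a₀ x + t • Function.update a₀ .F (a₀ .D) x
      rw [ev_dt_ABD_eq_zero (by simp [hAB, br_self]), mul_zero, zero_add] at h1
      exact (mul_eq_zero.1 h1).resolve_right ht
    · have hDC : br (a₀ .D) (a₀ .C) ≠ 0 := fun h0 => hCD (by
        simp only [br] at h0 ⊢
        linear_combination -h0)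
      rw [ev_dt]
      simpa using ⟨⟨hED, hEC⟩, hDC⟩

/-- The two determinants are, up to units, combinations of the `F₂ k`, and these are combinations of
the determinants. Composing the two changes of generators gives at `a₀` an invertible diagonal 2 × 2
matrix, so (P, Q) has rank two there. -/
theorem Setting.nonempty_localEquations {N₁ N₂ : ℕ} {F₁ : Fin N₁ → Poly six}
    {F₂ : Fin N₂ → Poly (ext six N₁)} {h : MProj six} {a₀ : Letter → Fin 2 → ℂ}
    (S : Setting F₁ F₂ h a₀) : Nonempty (LocalEquations (fun j => res F₁ (F₂ j)) a₀) := by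
  have hne : ∀ i j, ¬ Paired i j → br (a₀ i) (a₀ j) ≠ 0 := fun i j hij => S.br_ne_zero hij
  obtain ⟨d₁, hd₁, -⟩ := id S.gen₁
  obtain ⟨d₂, hd₂, -⟩ := id S.gen₂
  obtain ⟨g, hg⟩ := IsForm.exists_res hd₁ d₂
  obtain ⟨U, u, P, Q, p, q, hU, hU0, hP, hQ, hpq, hrel⟩ :=
    exists_cofactors (fun j => hg _ (hd₂ j)) S.ev_res_F₂_eq_zero
  have hUa := hU0 a₀ (hne _ _ (by decide)) (hne _ _ (by decide)) (hne _ _ (by decide))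
    (hne _ _ (by decide))
  obtain ⟨V, B, hV, hVB⟩ := S.exists_relation_F₂ (isForm_dt .A .B .D) fun a h1 _ =>
    ev_dt_ABD_eq_zero h1
  obtain ⟨V', B', hV', hVB'⟩ := S.exists_relation_F₂ (isForm_dt .E .F .C) fun a _ h1 =>
    ev_dt_EFC_eq_zero h1
  have hsum : ∀ (a : Letter → Fin 2 → ℂ) (B : Fin N₂ → Poly six),
      ev (cv a) U * ∑ k, ev (cv a) (B k) * ev (cv a) (res F₁ (F₂ k)) =
        ev (cv a) (∑ k, B k * P k) * ev (cv a) (dt .A .B .D) +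
        ev (cv a) (∑ k, B k * Q k) * ev (cv a) (dt .E .F .C) := by
    intro a B
    simp only [map_sum, map_mul, Finset.mul_sum, Finset.sum_mul, ← Finset.sum_add_distrib]
    refine Finset.sum_congr rfl fun k _ => ?_
    linear_combination ev (cv a) (B k) * hrel a k
  have hcoef := @coefficients_eq_zero a₀ S.eq_AB S.eq_EF (hne _ _ (by decide)) (hne _ _ (by decide))
    (hne _ _ (by decide)) (hne _ _ (by decide)) (hne _ _ (by decide))
  obtain ⟨h1, h2⟩ := hcoef (R := U * V - ∑ k, B k * P k) (T := -∑ k, B k * Q k) fun a => by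
    rw [map_sub, map_neg, map_mul]
    linear_combination ev (cv a) U * hVB a + hsum a B
  obtain ⟨h3, h4⟩ := hcoef (R := -∑ k, B' k * P k) (T := U * V' - ∑ k, B' k * Q k) fun a => by
    rw [map_sub, map_neg, map_mul]
    linear_combination ev (cv a) U * hVB' a + hsum a B'
  have hminor : ∃ i j,
      ev (cv a₀) (P i) * ev (cv a₀) (Q j) - ev (cv a₀) (P j) * ev (cv a₀) (Q i) ≠ 0 := by
    by_contra! h0
    -- Cauchy–Binet: the determinant of the composite is a combination of the 2 × 2 minors of (P,
    -- Q), yet it equals (U V)(U V') at `a₀`.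
    have h5 : ev (cv a₀) (∑ k, B k * P k) * ev (cv a₀) (∑ k, B' k * Q k) -
        ev (cv a₀) (∑ k, B k * Q k) * ev (cv a₀) (∑ k, B' k * P k) = 0 := by
      simp only [map_sum, map_mul, Finset.sum_mul_sum, ← Finset.sum_sub_distrib]
      refine Finset.sum_eq_zero fun i _ => Finset.sum_eq_zero fun j _ => ?_
      linear_combination ev (cv a₀) (B i) * ev (cv a₀) (B' j) * h0 i j
    rw [map_sub, map_mul, sub_eq_zero] at h1 h4
    rw [map_neg, neg_eq_zero] at h2 h3
    rw [h2, zero_mul, sub_zero, ← h1, ← h4] at h5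
    exact mul_ne_zero (mul_ne_zero hUa hV) (mul_ne_zero hUa hV') h5
  obtain ⟨i, j, hij⟩ := hminor
  exact ⟨⟨U, u, P, Q, p, q, hU, hUa, hP, hQ, hpq, hrel, i, j, hij⟩⟩

end Pascal

/-! ### The fibre of the composite blow-up -/

namespace Pascal

open Matrix Filter Topology

variable {N₁ N₂ : ℕ} {F₁ : Fin N₁ → Poly six} {F₂ : Fin N₂ → Poly (ext six N₁)}
  {h : MProj six} {a₀ : Letter → Fin 2 → ℂ}

/-- The points of the graphs above sextuples of distinct points. -/
def distinctGraph (F₁ : Fin N₁ → Poly six) (F₂ : Fin N₂ → Poly (ext six N₁)) :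
    Set (MProj (ext (ext six N₁) N₂)) :=
  graph (graph distinctSextuples F₁) F₂

theorem graph_mono {ι : Type} {n : ι → ℕ} {N : ℕ} {S T : Set (MProj n)} (hST : S ⊆ T)
    (F : Fin N → Poly n) : graph S F ⊆ graph T F :=
  fun _ hx => ⟨hST hx.1, hx.2⟩

theorem distinctGraph_subset : distinctGraph F₁ F₂ ⊆ X F₁ F₂ :=
  (graph_mono ((graph_mono distinctSextuples_subset F₁).trans (graph_subset_blowup _ _)) F₂).trans
    (graph_subset_blowup _ _)

namespace Setting

/-- Density of the distinct sextuples passes up through both graphs. An equation on the blow-up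
therefore has to be checked only where all coordinates are explicit in the parameters. -/
theorem X_subset (S : Setting F₁ F₂ h a₀) :
    X F₁ F₂ ⊆ zariskiClosure (distinctGraph F₁ F₂) := by
  obtain ⟨d₁, hd₁, -⟩ := S.gen₁
  obtain ⟨d₂, hd₂, -⟩ := S.gen₂
  exact blowup_subset_zariskiClosure hd₂ (blowup_subset_zariskiClosure hd₁
    Hcirc_subset_zariskiClosure)

theorem exists_lift_distinctGraph (S : Setting F₁ F₂ h a₀) {t : MProj (ext (ext six N₁) N₂)}
    (ht : t ∈ distinctGraph F₁ F₂) :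
    ∃ b, Lift (cv b) (beta t) ∧ beta t ∈ distinctSextuples ∧
      Lift (snoc (gr F₁ (cv b)) fun j => ev (cv b) (res F₁ (F₂ j))) t := by
  obtain ⟨d₁, hd₁, -⟩ := S.gen₁
  obtain ⟨d₂, hd₂, -⟩ := S.gen₂
  obtain ⟨b, hb, -⟩ := exists_rep_eq_cv ht.1.1.1
  have h0 : Lift (cv b) (beta t) := hb ▸ lift_rep (base (base t))
  have h1 := ((mem_graph_iff hd₁ h0).1 ht.1).2
  have h2 := ((mem_graph_iff hd₂ h1).1 ht).2
  refine ⟨b, h0, ht.1.1, ?_⟩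
  simp only [ev_res]
  exact h2

end Setting

/-- A form that vanishes at the sextuples of distinct points vanishes on the blow-up. -/
theorem Setting.val_eq_zero_of_distinct (S : Setting F₁ F₂ h a₀) {x : MProj (ext (ext six N₁) N₂)}
    (hx : x ∈ X F₁ F₂) {G : Poly (ext (ext six N₁) N₂)} {d : Option (Option Letter) →₀ ℕ}
    (hG : IsForm G d)
    (h0 : ∀ b, ev (snoc (gr F₁ (cv b)) fun j => ev (cv b) (res F₁ (F₂ j))) G = 0) :
    val x G = 0 := by
  refine S.X_subset hx G d hG fun t ht => ?_
  obtain ⟨b, -, -, hb⟩ := S.exists_lift_distinctGraph ht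
  exact (hb.val_eq_zero hG).2 (h0 b)

/-- A form on the space of sextuples, as a form on the ambient space of the second blow-up. -/
def emb₂ (N₁ N₂ : ℕ) (G : Poly six) : Poly (ext (ext six N₁) N₂) := emb N₂ (emb N₁ G)

theorem ev_emb₂ (b : ∀ x, Fin (six x) → ℂ) (y : Fin N₁ → ℂ) (z : Fin N₂ → ℂ) (G : Poly six) :
    ev (snoc (snoc b y) z) (emb₂ N₁ N₂ G) = ev b G := by
  rw [emb₂, ev_emb, ev_emb]

theorem val_emb₂ (x : MProj (ext (ext six N₁) N₂)) (G : Poly six) :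
    val x (emb₂ N₁ N₂ G) = val (beta x) G := by
  rw [emb₂, val_emb, val_emb, beta]

theorem IsForm.emb₂ {G : Poly six} {d : Letter →₀ ℕ} (hG : IsForm G d) (N₁ N₂ : ℕ) :
    IsForm (emb₂ N₁ N₂ G) (embDeg (embDeg d)) :=
  (hG.emb N₁).emb N₂

namespace LocalEquations

/-- The parametrization of the fibre. -/
def param (L : LocalEquations (fun j => res F₁ (F₂ j)) a₀) : (Fin 2 → ℂ) →ₗ[ℂ] (Fin N₂ → ℂ) where
  toFun z k := ev (cv a₀) (L.P k) * z 0 + ev (cv a₀) (L.Q k) * z 1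
  map_add' z w := by
    funext k
    simp only [Pi.add_apply]
    ring
  map_smul' c z := by
    funext k
    simp only [Pi.smul_apply, smul_eq_mul, RingHom.id_apply]
    ring

theorem param_apply (L : LocalEquations (fun j => res F₁ (F₂ j)) a₀) (z : Fin 2 → ℂ) (k : Fin N₂) :
    L.param z k = ev (cv a₀) (L.P k) * z 0 + ev (cv a₀) (L.Q k) * z 1 := rfl

theorem param_injective (L : LocalEquations (fun j => res F₁ (F₂ j)) a₀) :
    Function.Injective L.param := by
  rw [injective_iff_map_eq_zero]
  intro z hz
  have h1 := congrFun hz L.i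
  have h2 := congrFun hz L.j
  simp only [param_apply, Pi.zero_apply] at h1 h2
  have h3 := L.minor_ne_zero
  funext k
  refine mul_left_cancel₀ h3 ?_
  fin_cases k
  · simp only [Fin.zero_eta, Pi.zero_apply, mul_zero]
    linear_combination ev (cv a₀) (L.Q L.j) * h1 - ev (cv a₀) (L.Q L.i) * h2
  · simp only [Fin.mk_one, Pi.zero_apply, mul_zero]
    linear_combination ev (cv a₀) (L.P L.i) * h2 - ev (cv a₀) (L.P L.j) * h1

/-- The last coordinates of a point of the fibre lie in the range of `param`. -/
theorem exists_param_eq (S : Setting F₁ F₂ h a₀)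
    (L : LocalEquations (fun j => res F₁ (F₂ j)) a₀) {x : MProj (ext (ext six N₁) N₂)}
    (hx : x ∈ fibre F₁ F₂ h) : ∃ z, (last x).rep = L.param z := by
  -- `U` times the 3 × 3 determinant of the rows i, j, k of (P, Q, y), where y stands for the new
  -- coordinates. It vanishes on the graph because U F₂ lies in the column space of (P, Q).
  have hmin : ∀ k, val x (emb₂ N₁ N₂ L.U *
      (emb₂ N₁ N₂ (L.P L.i) * emb₂ N₁ N₂ (L.Q L.j) * newX _ k -
        emb₂ N₁ N₂ (L.P L.j) * emb₂ N₁ N₂ (L.Q L.i) * newX _ k -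
      (emb₂ N₁ N₂ (L.P k) * emb₂ N₁ N₂ (L.Q L.j) * newX _ L.i -
        emb₂ N₁ N₂ (L.P k) * emb₂ N₁ N₂ (L.Q L.i) * newX _ L.j) -
      (emb₂ N₁ N₂ (L.P L.i) * emb₂ N₁ N₂ (L.Q k) * newX _ L.j -
        emb₂ N₁ N₂ (L.P L.j) * emb₂ N₁ N₂ (L.Q k) * newX _ L.i))) = 0 := by
    intro k
    have hf : ∀ i j l, IsForm (emb₂ N₁ N₂ (L.P i) * emb₂ N₁ N₂ (L.Q j) * newX (ext six N₁) l) _ :=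
      fun i j l => (((L.isForm_P i).emb₂ N₁ N₂).mul ((L.isForm_Q j).emb₂ N₁ N₂)).mul
        (IsForm.newX l)
    refine S.val_eq_zero_of_distinct hx.1 ((L.isForm_U.emb₂ N₁ N₂).mul
      ((((hf _ _ _).sub (hf _ _ _)).sub ((hf _ _ _).sub (hf _ _ _))).sub
        ((hf _ _ _).sub (hf _ _ _)))) fun b => ?_
    simp only [map_mul, map_sub, ev_newX, gr, ev_emb₂]
    linear_combination
      (ev (cv b) (L.P L.i) * ev (cv b) (L.Q L.j) - ev (cv b) (L.P L.j) * ev (cv b) (L.Q L.i)) *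
        L.relation b k -
      (ev (cv b) (L.P k) * ev (cv b) (L.Q L.j) - ev (cv b) (L.P L.j) * ev (cv b) (L.Q k)) *
        L.relation b L.i -
      (ev (cv b) (L.P L.i) * ev (cv b) (L.Q k) - ev (cv b) (L.P k) * ev (cv b) (L.Q L.i)) *
        L.relation b L.j
  simp only [val_mul, val_sub, val_emb₂, val_newX, hx.2, S.val_eq, mul_eq_zero, L.ev_U_ne_zero,
    false_or] at hmin
  have h3 := L.minor_ne_zero
  set Δ := ev (cv a₀) (L.P L.i) * ev (cv a₀) (L.Q L.j) - ev (cv a₀) (L.P L.j) * ev (cv a₀) (L.Q L.i)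
    with hΔ
  refine ⟨![(ev (cv a₀) (L.Q L.j) * (last x).rep L.i - ev (cv a₀) (L.Q L.i) * (last x).rep L.j) / Δ,
    (ev (cv a₀) (L.P L.i) * (last x).rep L.j - ev (cv a₀) (L.P L.j) * (last x).rep L.i) / Δ],
    funext fun k => ?_⟩
  rw [param_apply]
  simp only [cons_val_zero, cons_val_one]
  rw [mul_div_assoc', mul_div_assoc', ← add_div, eq_div_iff h3, hΔ]
  linear_combination hmin k

/-- Points in the range of `param` are limits of points of the graph. -/
theorem mem_fibre_of_param (S : Setting F₁ F₂ h a₀)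
    (L : LocalEquations (fun j => res F₁ (F₂ j)) a₀) {x : MProj (ext (ext six N₁) N₂)}
    {z : Fin 2 → ℂ} (hx : Lift (snoc (gr F₁ (cv a₀)) (L.param z)) x) : x ∈ fibre F₁ F₂ h := by
  obtain ⟨d₁, hd₁, -⟩ := id S.gen₁
  obtain ⟨d₂, hd₂, -⟩ := id S.gen₂
  obtain ⟨k, hk⟩ := S.exists_F₁_ne_zero
  have hβ : beta x = h := hx.base.base.unique S.lift
  have hbase : base x ∈ blowup Hcirc F₁ := graph_subset_blowup _ _
    ((mem_graph_iff hd₁ hx.base.base).2 ⟨by rw [← beta, hβ]; exact S.mem_Hcirc, hx.base⟩)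
  refine ⟨⟨hbase, fun Φ e hΦ hΦ0 => ?_⟩, hβ⟩
  have hAD : br (a₀ .A) (a₀ .D) ≠ 0 := S.br_ne_zero (by decide)
  have hEC : br (a₀ .E) (a₀ .C) ≠ 0 := S.br_ne_zero (by decide)
  -- B leaves A in the direction of D, and F leaves E in the direction of C. Each determinant is
  -- then linear in τ, and the division by the cube of a bracket makes them exactly τ z₀ and τ z₁.
  let b : ℂ → Letter → Fin 2 → ℂ := fun τ => fun
    | .B => a₀ .A + (τ * (z 0 / br (a₀ .A) (a₀ .D) ^ 3)) • a₀ .D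
    | .F => a₀ .E + (τ * (z 1 / br (a₀ .E) (a₀ .C) ^ 3)) • a₀ .C
    | .A => a₀ .A | .C => a₀ .C | .D => a₀ .D | .E => a₀ .E
  have hb0 : b 0 = a₀ := by
    funext l
    cases l <;> simp [b, S.eq_AB, S.eq_EF]
  have hα : ∀ τ, ev (cv (b τ)) (dt .A .B .D) = τ * z 0 := by
    intro τ
    have h1 : br (b τ .A) (b τ .B) = τ * (z 0 / br (a₀ .A) (a₀ .D) ^ 3) * br (a₀ .A) (a₀ .D) := by
      simp [b, br]
      ring
    have h2 : br (b τ .B) (b τ .D) = br (a₀ .A) (a₀ .D) := by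
      simp [b, br]
      ring
    rw [ev_dt, h1, h2, show br (b τ .A) (b τ .D) = br (a₀ .A) (a₀ .D) from rfl]
    field_simp
  have hε : ∀ τ, ev (cv (b τ)) (dt .E .F .C) = τ * z 1 := by
    intro τ
    have h1 : br (b τ .E) (b τ .F) = τ * (z 1 / br (a₀ .E) (a₀ .C) ^ 3) * br (a₀ .E) (a₀ .C) := by
      simp [b, br]
      ring
    have h2 : br (b τ .F) (b τ .C) = br (a₀ .E) (a₀ .C) := by
      simp [b, br]
      ring
    rw [ev_dt, h1, h2, show br (b τ .E) (b τ .C) = br (a₀ .E) (a₀ .C) from rfl]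
    field_simp
  have hbc : ∀ l i, Continuous fun τ => b τ l i := by
    intro l i
    cases l <;> simp only [b, Pi.add_apply, Pi.smul_apply, smul_eq_mul] <;> fun_prop
  have hcv : ∀ l i, Continuous fun τ => cv (b τ) l i := by
    intro l i
    change Fin 3 at i
    have h0 := hbc l 0
    have h1 := hbc l 1
    fin_cases i
    · exact h0.pow 2
    · exact h0.mul h1
    · exact h1.pow 2
  have hcont : ∀ G : Poly six, Continuous fun τ => ev (cv (b τ)) G := fun G => continuous_ev G hcv
  let y : ℂ → Fin N₂ → ℂ := fun τ k =>
    ev (cv (b τ)) (L.P k) * z 0 + ev (cv (b τ)) (L.Q k) * z 1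
  have hy : ∀ k, Continuous fun τ => y τ k := fun k =>
    ((hcont _).mul continuous_const).add ((hcont _).mul continuous_const)
  have hy0 : y 0 = L.param z := by
    funext k
    simp only [y, hb0]
    rfl
  let w : ℂ → ∀ o, Fin (ext (ext six N₁) N₂ o) → ℂ := fun τ => snoc (gr F₁ (cv (b τ))) (y τ)
  have hw : ∀ o i, Continuous fun τ => w τ o i := by
    rintro (_ | _ | l) i
    · exact hy i
    · exact hcont (F₁ i)
    · exact hcv l i
  have hw0 : w 0 = snoc (gr F₁ (cv a₀)) (L.param z) := by
    simp only [w, hb0, hy0]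
  rw [hx.val_eq_zero hΦ, ← hw0]
  obtain ⟨m, hm⟩ := Function.ne_iff.1 (hx none).1
  have hne : ∀ {f : ℂ → ℂ}, Continuous f → f 0 ≠ 0 → ∀ᶠ τ in 𝓝[≠] 0, f τ ≠ 0 := fun hf h0 =>
    (hf.continuousAt.eventually_ne h0).filter_mono nhdsWithin_le_nhds
  -- For small τ ≠ 0 the values of the `F₂ k` are τ / U times `y τ`, so the point with last
  -- coordinates `y τ` lies on the graph. At τ = 0 all the `F₂ k` vanish, hence the passage to the
  -- limit.
  have hev : ∀ᶠ τ in 𝓝[≠] (0 : ℂ), ev (w τ) Φ = 0 := by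
    filter_upwards [hne (hcont (sepForm h)) (by rw [hb0]; exact S.lift.ev_sepForm_ne_zero),
      hne (hcont (F₁ k)) (by rw [hb0]; exact hk),
      hne (hcont L.U) (by rw [hb0]; exact L.ev_U_ne_zero),
      hne (hy m) (by rw [hy0]; exact hm), self_mem_nhdsWithin] with τ h1 h2 h3 h4 h5
    have h5 : τ ≠ 0 := h5
    obtain ⟨t, ht, htl, -⟩ := S.exists_lift_gr h1 h2
    have hrel : ∀ k, ev (cv (b τ)) L.U * ev (cv (b τ)) (res F₁ (F₂ k)) = τ * y τ k := by
      intro k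
      rw [L.relation, hα, hε]
      simp only [y]
      ring
    have hyτ : y τ ≠ 0 := fun h0 => h4 (congrFun h0 m)
    have heq : (fun k => ev (cv (b τ)) (res F₁ (F₂ k))) =
        (τ / ev (cv (b τ)) L.U) • y τ := by
      funext k
      rw [Pi.smul_apply, smul_eq_mul, div_mul_eq_mul_div, eq_div_iff h3, ← hrel]
      ring
    have hg : (fun k => ev (cv (b τ)) (res F₁ (F₂ k))) ≠ 0 := by
      rw [heq]
      exact smul_ne_zero (div_ne_zero h5 h3) hyτ
    obtain ⟨v, hv⟩ := exists_lift (w := w τ) (by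
      rintro (_ | o)
      · exact hyτ
      · exact (htl o).1)
    have hvb : base v = t := hv.base.unique htl
    refine (hv.val_eq_zero hΦ).1 (hΦ0 v ((mem_graph_iff hd₂ hv.base).2
      ⟨hvb ▸ graph_subset_blowup _ _ ht, ?_⟩))
    rw [gr, lift_snoc_iff]
    simp only [ev_res] at hg heq
    exact ⟨hv.base, hg, (hv none).2.trans (mk_smul_eq _ _ heq).symm⟩
  have hlim : Tendsto (fun τ => ev (w τ) Φ) (𝓝[≠] 0) (𝓝 (ev (w 0) Φ)) :=
    (continuous_ev Φ hw).continuousAt.tendsto.mono_left nhdsWithin_le_nhds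
  exact tendsto_nhds_unique hlim (tendsto_const_nhds.congr' (hev.mono fun _ h => h.symm))

theorem mem_fibre_iff (S : Setting F₁ F₂ h a₀) (L : LocalEquations (fun j => res F₁ (F₂ j)) a₀)
    {x : MProj (ext (ext six N₁) N₂)} :
    x ∈ fibre F₁ F₂ h ↔ ∃ z, Lift (snoc (gr F₁ (cv a₀)) (L.param z)) x := by
  constructor
  · intro hx
    obtain ⟨d₁, hd₁, -⟩ := id S.gen₁
    obtain ⟨k, hk⟩ := S.exists_F₁_ne_zero
    obtain ⟨z, hz⟩ := L.exists_param_eq S hx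
    have hβ : Lift (cv a₀) (base (base x)) := by
      have : base (base x) = h := hx.2
      rw [this]
      exact S.lift
    have h1 : base x ∈ graph Hcirc F₁ := mem_graph_of_mem_blowup hd₁ hx.1.1 fun h0 => hk (by
      have : val (base (base x)) (F₁ k) = 0 := congrFun h0 k
      exact (hβ.val_eq_zero (hd₁ k)).1 this)
    refine ⟨z, lift_snoc_iff.2 ⟨((mem_graph_iff hd₁ hβ).1 h1).2, ?_⟩⟩
    rw [← hz]
    exact ⟨(last x).rep_nonzero, (Projectivization.mk_rep _).symm⟩
  · rintro ⟨z, hz⟩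
    exact L.mem_fibre_of_param S hz

end LocalEquations

end Pascal

namespace Pascal

open Matrix

/-! ## Linear maps between projective spaces -/

section

variable {ι κ : Type} {n : ι → ℕ}

theorem isRegular_of_linear {N : ℕ} {i : ι} (A : (Fin (n i) → ℂ) →ₗ[ℂ] (Fin N → ℂ))
    {φ : MProj n → ℙ ℂ (Fin N → ℂ)} {S : Set (MProj n)}
    (hφ : ∀ x ∈ S, ∃ hx : A (x i).rep ≠ 0, φ x = Projectivization.mk ℂ _ hx) : IsRegular φ S := by
  let G : Fin N → Poly n := fun j =>
    ∑ l, MvPolynomial.C (A (Pi.single l 1) j) * MvPolynomial.X ⟨i, l⟩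
  have hG : ∀ x, vals G x = A (x i).rep := by
    intro x
    funext j
    rw [LinearMap.pi_apply_eq_sum_univ A (x i).rep]
    simp only [vals, G, val, map_sum, map_mul, MvPolynomial.eval_C, MvPolynomial.eval_X,
      Finset.sum_apply, Pi.smul_apply, smul_eq_mul]
    refine Finset.sum_congr rfl fun l _ => ?_
    rw [mul_comm]
    have : (Pi.single l 1 : Fin (n i) → ℂ) = fun l' => if l = l' then 1 else 0 := by
      funext l'
      simp [Pi.single_apply, eq_comm]
    rw [this]
  refine fun x hx => ⟨Finsupp.single i 1, G, fun j => IsForm.sum _ fun l _ =>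
    (IsForm.X (n := n) ⟨i, l⟩).C_mul _, ?_, fun y hy hy0 => ?_⟩
  · rw [hG]
    exact (hφ x hx).1
  · obtain ⟨h1, h2⟩ := hφ y hy
    rw [h2]
    simp only [hG]

theorem IsIsoOn.exists_symm {m : κ → ℕ} {φ : MProj n → MProj m} {S : Set (MProj n)}
    {T : Set (MProj m)} (h : IsIsoOn φ S T) : ∃ ψ, IsIsoOn ψ T S := by
  obtain ⟨h1, h2, ψ, h3, h4, h5⟩ := h
  exact ⟨ψ, h3, h4, φ, h1, h2, h5.symm⟩

open Classical in
/-- The point with homogeneous coordinates `v`, or `e` if `v = 0`. -/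
def mkOr {N : ℕ} (e : ℙ ℂ (Fin N → ℂ)) (v : Fin N → ℂ) : ℙ ℂ (Fin N → ℂ) :=
  if hv : v ≠ 0 then Projectivization.mk ℂ v hv else e

theorem mkOr_of_ne {N : ℕ} (e : ℙ ℂ (Fin N → ℂ)) {v : Fin N → ℂ} (hv : v ≠ 0) :
    mkOr e v = Projectivization.mk ℂ v hv :=
  dif_pos hv

/-- Two linear systems parametrized by the same projective space are isomorphic. -/
theorem isIsoOn_of_linear {k N m : ℕ} (e : ℙ ℂ (Fin N → ℂ)) (x₁ : MProj n) (A : (Fin k → ℂ) →ₗ[ℂ] (Fin N → ℂ))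
    (K : (Fin k → ℂ) →ₗ[ℂ] (Fin m → ℂ)) (hA : Function.Injective A) (hK : Function.Injective K)
    {S : Set (MProj (ext n N))} {T : Set (MProj fun _ : Unit => m)}
    (hS : ∀ x, x ∈ S ↔ base x = x₁ ∧ ∃ z, ∃ hz : A z ≠ 0, last x = Projectivization.mk ℂ _ hz)
    (hT : ∀ y, y ∈ T ↔ ∃ z, ∃ hz : K z ≠ 0, y () = Projectivization.mk ℂ _ hz)
    {f : MProj (ext n N) → ℙ ℂ (Fin m → ℂ)} (hf : IsRegular f S)
    (hfK : ∀ x ∈ S, ∀ z (hz : A z ≠ 0), last x = Projectivization.mk ℂ _ hz →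
      ∃ hz' : K z ≠ 0, f x = Projectivization.mk ℂ _ hz') :
    IsIsoOn (fun x _ => f x) S T := by
  refine ⟨fun _ => hf, fun x hx => ?_, ?_⟩
  · obtain ⟨-, z, hz, hxz⟩ := (hS x).1 hx
    exact (hT _).2 ⟨z, hfK x hx z hz hxz⟩
  obtain ⟨g, hg⟩ := LinearMap.exists_leftInverse_of_injective K (LinearMap.ker_eq_bot.2 hK)
  have hAK : ∀ z, K z ≠ 0 → A z ≠ 0 := fun z hz h0 => hz (by
    rw [hA (h0.trans (map_zero A).symm), map_zero])
  -- The inverse map lifts a point through a left inverse of `K` and applies `A`. It is given by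
  -- linear forms on the whole space, although it is meaningful only on the image of `K`.
  let B : (Fin m → ℂ) →ₗ[ℂ] (Fin N → ℂ) := A ∘ₗ g
  have hB : ∀ z (hz : K z ≠ 0), ∃ h : B (Projectivization.mk ℂ _ hz).rep ≠ 0,
      Projectivization.mk ℂ _ h = Projectivization.mk ℂ _ (hAK z hz) := by
    intro z hz
    obtain ⟨c, hc⟩ := Projectivization.exists_smul_eq_mk_rep ℂ _ hz
    have h1 : B (Projectivization.mk ℂ _ hz).rep = (c : ℂ) • A z := by
      rw [← hc, Units.smul_def, map_smul]
      exact congrArg (fun v => (c : ℂ) • A v) (LinearMap.congr_fun hg z)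
    refine ⟨?_, mk_smul_eq _ _ h1⟩
    rw [h1]
    exact smul_ne_zero c.ne_zero (hAK z hz)
  let ψ : MProj (fun _ : Unit => m) → MProj (ext n N) := fun y o => match o with
    | some i => x₁ i
    | none => mkOr e (B (y ()).rep)
  have hψ : ∀ y, ∀ z (hz : K z ≠ 0), y () = Projectivization.mk ℂ _ hz →
      base (ψ y) = x₁ ∧ last (ψ y) = Projectivization.mk ℂ _ (hAK z hz) := by
    intro y z hz hy
    refine ⟨rfl, ?_⟩
    obtain ⟨h1, h2⟩ := hB z hz
    rw [← h2]
    change mkOr e (B (y ()).rep) = _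
    rw [hy, mkOr_of_ne e h1]
  have hmaps : Set.MapsTo ψ T S := by
    intro y hy
    obtain ⟨z, hz, hyz⟩ := (hT y).1 hy
    exact (hS _).2 ⟨(hψ y z hz hyz).1, z, hAK z hz, (hψ y z hz hyz).2⟩
  refine ⟨ψ, ?_, hmaps, ?_, ?_⟩
  · rintro (_ | i)
    · refine isRegular_of_linear (n := fun _ : Unit => m) (i := ()) B fun y hy => ?_
      obtain ⟨z, hz, hyz⟩ := (hT y).1 hy
      obtain ⟨h1, -⟩ := hB z hz
      rw [← hyz] at h1
      exact ⟨h1, mkOr_of_ne e h1⟩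
    · exact isRegular_const _ _
  · intro x hx
    obtain ⟨hx1, z, hz, hxz⟩ := (hS x).1 hx
    obtain ⟨hz', hfx⟩ := hfK x hx z hz hxz
    obtain ⟨h1, h2⟩ := hψ (fun _ => f x) z hz' hfx
    funext o
    cases o with
    | none => exact h2.trans hxz.symm
    | some i => exact congrFun (h1.trans hx1.symm) i
  · intro y hy
    obtain ⟨z, hz, hyz⟩ := (hT y).1 hy
    obtain ⟨h1, h2⟩ := hψ y z hz hyz
    obtain ⟨h3, h4⟩ := hfK _ (hmaps hy) z _ h2
    funext u
    exact h4.trans hyz.symm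

end

/-! ## The Pascal line on the blow-up -/

/-- Line coordinates of the Pascal line. -/
def lineVec (b : Letter → Fin 2 → ℂ) : Fin 3 → ℂ :=
  (det3 (cv b .A) (cv b .B) (cv b .D) * det3 (cv b .C) (cv b .F) (cv b .D)) •
    (cv b .C ⨯₃ cv b .E) +
  (det3 (cv b .C) (cv b .E) (cv b .F) * det3 (cv b .A) (cv b .C) (cv b .D)) •
    (cv b .B ⨯₃ cv b .D)

/-- Coordinates of the intersection of the lines `x y` and `z t`. -/
def meetVec (b : Letter → Fin 2 → ℂ) (x y z t : Letter) : Fin 3 → ℂ :=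
  (cv b x ⨯₃ cv b y) ⨯₃ (cv b z ⨯₃ cv b t)

theorem lineVec_eq_cross (b : Letter → Fin 2 → ℂ) :
    lineVec b = meetVec b .A .D .C .F ⨯₃ meetVec b .B .D .C .E :=
  (cross_cross_cross _ _ _ _ _ _).symm

theorem lineVec_dot_AEBF (b : Letter → Fin 2 → ℂ) : lineVec b ⬝ᵥ meetVec b .A .E .B .F = 0 :=
  pascal_conicVec _ _ _ _ _ _

theorem lineVec_dot_ADCF (b : Letter → Fin 2 → ℂ) : lineVec b ⬝ᵥ meetVec b .A .D .C .F = 0 := by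
  rw [lineVec_eq_cross, dotProduct_comm, dot_self_cross]

theorem lineVec_dot_BDCE (b : Letter → Fin 2 → ℂ) : lineVec b ⬝ᵥ meetVec b .B .D .C .E = 0 := by
  rw [lineVec_eq_cross, dotProduct_comm, dot_cross_self]

/-- The two joining lines are distinct because `l` lies on the second but not on the first: the
cross product of the meeting vector with `l` is det(i,j,l) times the line kl. -/
theorem Lift.cross_cross {b : Letter → Fin 2 → ℂ} {y : MProj six} (hb : Lift (cv b) y)
    {i j k l : Letter} (hij : y i ≠ y j) (hkl : y k ≠ y l) (hil : y i ≠ y l) (hjl : y j ≠ y l) :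
    ∃ hne : meetVec b i j k l ≠ 0, Projectivization.cross (Projectivization.cross (y i) (y j))
      (Projectivization.cross (y k) (y l)) = Projectivization.mk ℂ _ hne := by
  have hc : ∀ {i j : Letter}, y i ≠ y j → cv b i ⨯₃ cv b j ≠ 0 := by
    intro i j hij h0
    obtain ⟨h1, h2⟩ := hb i
    obtain ⟨h3, h4⟩ := hb j
    rw [h2, h4] at hij
    exact hij ((Projectivization.mk_eq_mk_iff_crossProduct_eq_zero h1 h3).2 h0)
  have hbr : ∀ {i j : Letter}, y i ≠ y j → br (b i) (b j) ≠ 0 := fun hij h0 =>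
    hij ((hb.eq_iff _ _).2 h0)
  have hx : ∀ {i j : Letter} (hij : y i ≠ y j), Projectivization.cross (y i) (y j) =
      Projectivization.mk ℂ _ (hc hij) := by
    intro i j hij
    obtain ⟨h1, h2⟩ := hb i
    obtain ⟨h3, h4⟩ := hb j
    rw [h2, h4, Projectivization.cross_mk_of_cross_ne_zero _ _ (hc hij)]
  have hne : meetVec b i j k l ≠ 0 := by
    intro h0
    have h1 : meetVec b i j k l ⨯₃ cv b l =
        det3 (cv b i) (cv b j) (cv b l) • (cv b k ⨯₃ cv b l) := by
      funext m
      fin_cases m <;> simp [meetVec, det3_eq, cross_apply] <;> ring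
    rw [h0, LinearMap.map_zero, LinearMap.zero_apply, eq_comm, smul_eq_zero, or_iff_left (hc hkl)]
      at h1
    change det3 (conicVec _) (conicVec _) (conicVec _) = 0 at h1
    rw [det3_conicVec] at h1
    exact mul_ne_zero (mul_ne_zero (hbr hij) (hbr hil)) (hbr hjl) h1
  refine ⟨hne, ?_⟩
  rw [hx hij, hx hkl, Projectivization.cross_mk_of_cross_ne_zero _ _ hne]
  rfl

/-- The array of the Pascal line under consideration. -/
abbrev pascalArray : Matrix (Fin 2) (Fin 3) Letter := !![.A, .B, .C; .F, .E, .D]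

theorem isPascal_mk_iff {b : Letter → Fin 2 → ℂ} {y : MProj six} (hb : Lift (cv b) y)
    (hy : Function.Injective (β := ℙ ℂ (Fin 3 → ℂ)) y) {v : Fin 3 → ℂ} (hv : v ≠ 0) :
    IsPascal pascalArray y (Projectivization.mk ℂ v hv) ↔ v ⬝ᵥ meetVec b .A .E .B .F = 0 ∧
      v ⬝ᵥ meetVec b .A .D .C .F = 0 ∧ v ⬝ᵥ meetVec b .B .D .C .E = 0 := by
  have hne : ∀ {i j : Letter}, i ≠ j → y i ≠ y j := fun hij h0 => hij (hy h0)
  have key : ∀ {i j k l : Letter}, i ≠ j → k ≠ l → i ≠ l → j ≠ l →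
      ((Projectivization.mk ℂ v hv).orthogonal (Projectivization.cross
        (Projectivization.cross (y i) (y j)) (Projectivization.cross (y k) (y l))) ↔
        v ⬝ᵥ meetVec b i j k l = 0) := by
    intro i j k l h1 h2 h3 h4
    obtain ⟨h5, h6⟩ := hb.cross_cross (hne h1) (hne h2) (hne h3) (hne h4)
    rw [h6, Projectivization.orthogonal_mk]
  have k1 := key (i := .A) (j := .E) (k := .B) (l := .F) (by decide) (by decide) (by decide)
    (by decide)
  have k2 := key (i := .A) (j := .D) (k := .C) (l := .F) (by decide) (by decide) (by decide)
    (by decide)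
  have k3 := key (i := .B) (j := .D) (k := .C) (l := .E) (by decide) (by decide) (by decide)
    (by decide)
  rw [← k1, ← k2, ← k3]
  constructor
  · exact fun h => ⟨h 0 1 (by decide), h 0 2 (by decide), h 1 2 (by decide)⟩
  · rintro ⟨h1, h2, h3⟩ i j hij
    fin_cases i <;> fin_cases j
    · exact absurd hij (by decide)
    · exact h1
    · exact h2
    · exact absurd hij (by decide)
    · exact absurd hij (by decide)
    · exact h3
    · exact absurd hij (by decide)
    · exact absurd hij (by decide)
    · exact absurd hij (by decide)

/-- A vector orthogonal to two others is proportional to their cross product. Two of the three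
incidences thus determine the Pascal line. -/
theorem mul_lineVec_of_dot {b : Letter → Fin 2 → ℂ} {v : Fin 3 → ℂ}
    (h1 : v ⬝ᵥ meetVec b .A .D .C .F = 0) (h2 : v ⬝ᵥ meetVec b .B .D .C .E = 0) (i j : Fin 3) :
    v i * lineVec b j = v j * lineVec b i := by
  rw [lineVec_eq_cross]
  generalize meetVec b .A .D .C .F = p at *
  generalize meetVec b .B .D .C .E = q at *
  simp only [dotProduct, Fin.sum_univ_three] at h1 h2
  fin_cases i <;> fin_cases j <;> simp [cross_apply]
  · linear_combination p 2 * h2 - q 2 * h1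
  · linear_combination q 1 * h1 - p 1 * h2
  · linear_combination q 2 * h1 - p 2 * h2
  · linear_combination p 0 * h2 - q 0 * h1
  · linear_combination p 1 * h2 - q 1 * h1
  · linear_combination q 0 * h1 - p 0 * h2

variable {N₁ N₂ : ℕ} {F₁ : Fin N₁ → Poly six} {F₂ : Fin N₂ → Poly (ext six N₁)}
  {h : MProj six} {a₀ : Letter → Fin 2 → ℂ}

namespace LocalEquations

variable (L : LocalEquations (fun j => res F₁ (F₂ j)) a₀)

/-- Forms that give the extension of the Pascal map near the fibre. -/
def line (l : Fin 3) : Poly (ext (ext six N₁) N₂) :=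
  emb₂ N₁ N₂ L.U *
    (emb₂ N₁ N₂ (dt .C .F .D * (Xv .C ⨯₃ Xv .E) l * L.Q L.j) * newX _ L.i -
      emb₂ N₁ N₂ (dt .C .F .D * (Xv .C ⨯₃ Xv .E) l * L.Q L.i) * newX _ L.j +
    (emb₂ N₁ N₂ (dt .A .C .D * (Xv .B ⨯₃ Xv .D) l * L.P L.i) * newX _ L.j -
      emb₂ N₁ N₂ (dt .A .C .D * (Xv .B ⨯₃ Xv .D) l * L.P L.j) * newX _ L.i))

theorem exists_isForm_line : ∃ d, ∀ l, IsForm (L.line l) d := by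
  -- The two halves of the form have the same multidegree because P α and Q ε do.
  have hdeg : dtDeg .C .F .D + (Finsupp.single .C 1 + Finsupp.single .E 1) + L.q =
      dtDeg .A .C .D + (Finsupp.single .B 1 + Finsupp.single .D 1) + L.p := by
    have h1 := L.degree_eq
    ext x
    have h2 := DFunLike.congr_fun h1 x
    simp only [dtDeg, Finsupp.add_apply] at h2 ⊢
    omega
  have hQ : ∀ l k, IsForm (dt .C .F .D * (Xv .C ⨯₃ Xv .E) l * L.Q k) _ := fun l k =>
    ((isForm_dt _ _ _).mul (IsForm.cross (isForm_Xv _) (isForm_Xv _) l)).mul (L.isForm_Q k)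
  have hP : ∀ l k, IsForm (dt .A .C .D * (Xv .B ⨯₃ Xv .D) l * L.P k) _ := fun l k =>
    ((isForm_dt _ _ _).mul (IsForm.cross (isForm_Xv _) (isForm_Xv _) l)).mul (L.isForm_P k)
  rw [← hdeg] at hP
  refine ⟨_, fun l => (L.isForm_U.emb₂ N₁ N₂).mul (((((hQ l _).emb₂ N₁ N₂).mul
    (IsForm.newX _)).sub (((hQ l _).emb₂ N₁ N₂).mul (IsForm.newX _))).add
    ((((hP l _).emb₂ N₁ N₂).mul (IsForm.newX _)).sub
      (((hP l _).emb₂ N₁ N₂).mul (IsForm.newX _))))⟩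

theorem ev_cross_Xv (b : Letter → Fin 2 → ℂ) (x y : Letter) (l : Fin 3) :
    ev (cv b) ((Xv x ⨯₃ Xv y) l) = (cv b x ⨯₃ cv b y) l := by
  have := congrFun (ev_cross (cv b) (Xv x) (Xv y)) l
  rw [ev_cv_Xv, ev_cv_Xv] at this
  exact this

theorem ev_dt' (b : Letter → Fin 2 → ℂ) (x y z : Letter) :
    ev (cv b) (dt x y z) = det3 (cv b x) (cv b y) (cv b z) := by
  rw [dt, ev_det3, ev_cv_Xv, ev_cv_Xv, ev_cv_Xv]
  rfl

/-- Above sextuples of distinct points the forms `line` give the Pascal line. -/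
theorem ev_line (b : Letter → Fin 2 → ℂ) (l : Fin 3) :
    ev (snoc (gr F₁ (cv b)) fun j => ev (cv b) (res F₁ (F₂ j))) (L.line l) =
      (ev (cv b) (L.P L.i) * ev (cv b) (L.Q L.j) - ev (cv b) (L.P L.j) * ev (cv b) (L.Q L.i)) *
        lineVec b l := by
  have h1 : det3 (cv b .C) (cv b .E) (cv b .F) = det3 (cv b .E) (cv b .F) (cv b .C) := by
    simp only [det3_eq]
    ring
  simp only [line, map_mul, map_sub, map_add, ev_newX, gr, ev_emb₂, ev_cross_Xv, lineVec,
    Pi.add_apply, Pi.smul_apply, smul_eq_mul, h1, ← ev_dt']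
  -- Cramer's rule, with Δ = Pᵢ Qⱼ - Pⱼ Qᵢ: U (Qⱼ Fᵢ - Qᵢ Fⱼ) = Δ α and U (Pᵢ Fⱼ - Pⱼ Fᵢ) = Δ ε,
  -- where F stands for the restricted `F₂`.
  linear_combination
    (ev (cv b) (dt .C .F .D) * (cv b .C ⨯₃ cv b .E) l * ev (cv b) (L.Q L.j) -
      ev (cv b) (dt .A .C .D) * (cv b .B ⨯₃ cv b .D) l * ev (cv b) (L.P L.j)) *
        L.relation b L.i +
    (ev (cv b) (dt .A .C .D) * (cv b .B ⨯₃ cv b .D) l * ev (cv b) (L.P L.i) -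
      ev (cv b) (dt .C .F .D) * (cv b .C ⨯₃ cv b .E) l * ev (cv b) (L.Q L.i)) *
        L.relation b L.j

/-- The parametrization of the pencil of lines. -/
def pencilParam (a₀ : Letter → Fin 2 → ℂ) : (Fin 2 → ℂ) →ₗ[ℂ] (Fin 3 → ℂ) where
  toFun z := (z 0 * ev (cv a₀) (dt .C .F .D)) • (cv a₀ .C ⨯₃ cv a₀ .E) +
    (z 1 * ev (cv a₀) (dt .A .C .D)) • (cv a₀ .B ⨯₃ cv a₀ .D)
  map_add' z w := by
    simp only [Pi.add_apply]
    module
  map_smul' c z := by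
    simp only [Pi.smul_apply, smul_eq_mul, RingHom.id_apply]
    module

/-- On the fibre the same application of Cramer's rule returns z₀ and z₁ in place of α and ε, so the
common zero of the two coefficients of the Pascal line has disappeared. -/
theorem ev_line_param (z : Fin 2 → ℂ) (l : Fin 3) :
    ev (snoc (gr F₁ (cv a₀)) (L.param z)) (L.line l) = (ev (cv a₀) L.U *
      (ev (cv a₀) (L.P L.i) * ev (cv a₀) (L.Q L.j) -
        ev (cv a₀) (L.P L.j) * ev (cv a₀) (L.Q L.i))) * pencilParam a₀ z l := by
  simp only [line, map_mul, map_sub, map_add, ev_newX, gr, ev_emb₂, ev_cross_Xv, param_apply,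
    pencilParam, LinearMap.coe_mk, AddHom.coe_mk, Pi.add_apply, Pi.smul_apply, smul_eq_mul]
  ring

end LocalEquations

end Pascal

/-! ### The extended Pascal map on the fibre -/

namespace Pascal

open Matrix

variable {N₁ N₂ : ℕ} {F₁ : Fin N₁ → Poly six} {F₂ : Fin N₂ → Poly (ext six N₁)}
  {h : MProj six} {a₀ : Letter → Fin 2 → ℂ}

namespace LocalEquations

variable (L : LocalEquations (fun j => res F₁ (F₂ j)) a₀)

/-- Pairing with D kills the line BD and isolates z₀; pairing with C kills the line CE and isolates
z₁. -/
theorem pencilParam_injective (S : Setting F₁ F₂ h a₀) : Function.Injective (pencilParam a₀) := by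
  rw [injective_iff_map_eq_zero]
  intro z hz
  have hne : ∀ i j, ¬ Paired i j → br (a₀ i) (a₀ j) ≠ 0 := fun i j hij => S.br_ne_zero hij
  have hdt : ∀ i j k, ¬ Paired i j → ¬ Paired i k → ¬ Paired j k →
      ev (cv a₀) (dt i j k) ≠ 0 := by
    intro i j k h1 h2 h3
    rw [ev_dt]
    exact mul_ne_zero (mul_ne_zero (hne _ _ h1) (hne _ _ h2)) (hne _ _ h3)
  have h1 : z 0 * ev (cv a₀) (dt .C .F .D) * ev (cv a₀) (dt .C .E .D) =
      pencilParam a₀ z ⬝ᵥ cv a₀ .D := by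
    simp only [pencilParam, LinearMap.coe_mk, AddHom.coe_mk, ev_dt', det3_eq, dotProduct,
      Fin.sum_univ_three, Pi.add_apply, Pi.smul_apply, smul_eq_mul, cross_apply]
    simp
    ring
  have h2 : z 1 * ev (cv a₀) (dt .A .C .D) * ev (cv a₀) (dt .B .D .C) =
      pencilParam a₀ z ⬝ᵥ cv a₀ .C := by
    simp only [pencilParam, LinearMap.coe_mk, AddHom.coe_mk, ev_dt', det3_eq, dotProduct,
      Fin.sum_univ_three, Pi.add_apply, Pi.smul_apply, smul_eq_mul, cross_apply]
    simp
    ring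
  rw [hz, zero_dotProduct, mul_assoc, mul_eq_zero] at h1 h2
  have h3 := h1.resolve_right (mul_ne_zero (hdt _ _ _ (by decide) (by decide) (by decide))
    (hdt _ _ _ (by decide) (by decide) (by decide)))
  have h4 := h2.resolve_right (mul_ne_zero (hdt _ _ _ (by decide) (by decide) (by decide))
    (hdt _ _ _ (by decide) (by decide) (by decide)))
  funext k
  fin_cases k
  · exact h3
  · exact h4

theorem pencilParam_dot (S : Setting F₁ F₂ h a₀) (z : Fin 2 → ℂ) :
    pencilParam a₀ z ⬝ᵥ meetVec a₀ .A .D .E .C = 0 := by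
  have hB : cv a₀ .B = cv a₀ .A := by simp only [cv, S.eq_AB]
  simp only [pencilParam, LinearMap.coe_mk, AddHom.coe_mk, hB, meetVec, dotProduct,
    Fin.sum_univ_three, Pi.add_apply, Pi.smul_apply, smul_eq_mul, cross_apply]
  simp
  ring

/-- Both the image of the injective `pencilParam` and the lines through the base point form spaces
of dimension two, and one contains the other. -/
theorem exists_pencilParam_eq (S : Setting F₁ F₂ h a₀) (hR : meetVec a₀ .A .D .E .C ≠ 0)
    {v : Fin 3 → ℂ} (hv : v ⬝ᵥ meetVec a₀ .A .D .E .C = 0) : ∃ z, pencilParam a₀ z = v := by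
  let f : (Fin 3 → ℂ) →ₗ[ℂ] ℂ := dotProductBilin ℂ ℂ (meetVec a₀ .A .D .E .C)
  have hf : ∀ v, f v = meetVec a₀ .A .D .E .C ⬝ᵥ v := fun v => rfl
  have hle : LinearMap.range (pencilParam a₀) ≤ LinearMap.ker f := by
    rintro _ ⟨z, rfl⟩
    rw [LinearMap.mem_ker, hf, dotProduct_comm, pencilParam_dot S]
  have hsurj : LinearMap.range f = ⊤ := by
    refine LinearMap.range_eq_top.2 (LinearMap.surjective fun h0 => hR ?_)
    exact dotProduct_eq_zero _ fun w => by rw [← hf, h0, LinearMap.zero_apply]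
  have h1 := LinearMap.finrank_range_add_finrank_ker f
  have h2 := LinearMap.finrank_range_of_inj (pencilParam_injective S)
  rw [hsurj, finrank_top] at h1
  simp only [Module.finrank_self, Module.finrank_fin_fun] at h1 h2
  have h3 := Submodule.eq_of_le_of_finrank_le hle (by omega)
  have h4 : v ∈ LinearMap.ker f := by rw [LinearMap.mem_ker, hf, dotProduct_comm, hv]
  rw [← h3] at h4
  exact h4

/-- The extension of the Pascal map. -/
def pascalMap (e : ℙ ℂ (Fin 3 → ℂ)) (x : MProj (ext (ext six N₁) N₂)) : ℙ ℂ (Fin 3 → ℂ) :=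
  mkOr e (vals L.line x)

/-- The three incidences are identities in the parameters, two by construction of the line and the
third by Pascal's theorem. As equations between forms they persist on the whole blow-up. -/
theorem isPascal_pascalMap (S : Setting F₁ F₂ h a₀) (e : ℙ ℂ (Fin 3 → ℂ))
    {w : MProj (ext (ext six N₁) N₂)} (hw : w ∈ X F₁ F₂) (h0 : vals L.line w ≠ 0)
    (hinj : Function.Injective (β := ℙ ℂ (Fin 3 → ℂ)) (beta w)) :
    IsPascal pascalArray (beta w) (L.pascalMap e w) := by
  obtain ⟨d, hd⟩ := L.exists_isForm_line
  obtain ⟨b, hb, -⟩ := exists_rep_eq_cv hw.1.1.1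
  have hbl : Lift (cv b) (beta w) := hb ▸ lift_rep (beta w)
  rw [pascalMap, mkOr_of_ne _ h0, isPascal_mk_iff hbl hinj]
  have key : ∀ i j k l, (∀ b, lineVec b ⬝ᵥ meetVec b i j k l = 0) →
      vals L.line w ⬝ᵥ meetVec b i j k l = 0 := by
    intro i j k l hlm
    have hm : ∀ c m, ev (cv c) (((Xv i ⨯₃ Xv j) ⨯₃ (Xv k ⨯₃ Xv l)) m) = meetVec c i j k l m := by
      intro c m
      have := congrFun (ev_cross (cv c) (Xv i ⨯₃ Xv j) (Xv k ⨯₃ Xv l)) m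
      simp only [ev_cross_Xv] at this
      exact this
    have h1 := S.val_eq_zero_of_distinct hw
      (IsForm.dotProduct hd fun m => (IsForm.cross (IsForm.cross (isForm_Xv i) (isForm_Xv j))
        (IsForm.cross (isForm_Xv k) (isForm_Xv l)) m).emb₂ N₁ N₂) fun c => by
      have h2 := hlm c
      have h3 : ∀ m, ev (snoc (gr F₁ (cv c)) fun j => ev (cv c) (res F₁ (F₂ j)))
          (emb₂ N₁ N₂ (((Xv i ⨯₃ Xv j) ⨯₃ (Xv k ⨯₃ Xv l)) m)) = meetVec c i j k l m := by
        intro m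
        rw [gr, ev_emb₂, hm]
      rw [ev_dotProduct]
      simp only [ev_line, h3]
      rw [← smul_zero (ev (cv c) (L.P L.i) * ev (cv c) (L.Q L.j) -
        ev (cv c) (L.P L.j) * ev (cv c) (L.Q L.i)), ← h2, ← smul_dotProduct]
      rfl
    have h3 : ∀ m, val w (emb₂ N₁ N₂ (((Xv i ⨯₃ Xv j) ⨯₃ (Xv k ⨯₃ Xv l)) m)) =
        meetVec b i j k l m := by
      intro m
      rw [val_emb₂, val_eq_ev, ← hm]
      exact congrArg (fun v => ev v _) hb
    rw [val_eq_ev, ev_dotProduct] at h1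
    simp only [← val_eq_ev, h3] at h1
    exact h1
  exact ⟨key _ _ _ _ lineVec_dot_AEBF, key _ _ _ _ lineVec_dot_ADCF, key _ _ _ _ lineVec_dot_BDCE⟩

theorem isRegular_pascalMap (e : ℙ ℂ (Fin 3 → ℂ)) {W : Set (MProj (ext (ext six N₁) N₂))}
    (hW : ∀ x ∈ W, vals L.line x ≠ 0) : IsRegular (L.pascalMap e) W := by
  obtain ⟨d, hd⟩ := L.exists_isForm_line
  exact fun x hx => ⟨d, L.line, hd, hW x hx, fun y _ hy => mkOr_of_ne e hy⟩

/-- Existence comes from the forms `line`, which do not vanish together near `x`. For uniqueness,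
any competing local forms are proportional to `line` over distinct sextuples, and the minors
expressing this vanish at `x` by density. -/
theorem pascalValue_iff (S : Setting F₁ F₂ h a₀) (e : ℙ ℂ (Fin 3 → ℂ))
    {x : MProj (ext (ext six N₁) N₂)} (hx : x ∈ X F₁ F₂) (h0 : vals L.line x ≠ 0)
    (ℓ : ℙ ℂ (Fin 3 → ℂ)) : PascalValue F₁ F₂ pascalArray x ℓ ↔ ℓ = L.pascalMap e x := by
  obtain ⟨d, hd⟩ := L.exists_isForm_line
  constructor
  · rintro ⟨W, hW, hxW, φ, hφ, rfl, hφP⟩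
    obtain ⟨c, G, hG, hGx, hφG⟩ := hφ x hxW
    rw [hφG x hxW hGx, pascalMap, mkOr_of_ne e h0]
    refine mk_eq_mk_of_minors _ _ fun i j => ?_
    have h1 := mem_zariskiClosure_inter hW hxW (S.X_subset hx) distinctGraph_subset
      (G i * L.line j - G j * L.line i) _ (((hG i).mul (hd j)).sub ((hG j).mul (hd i))) ?_
    · rw [val_sub, val_mul, val_mul, sub_eq_zero] at h1
      exact h1
    · rintro t ⟨ht, htW⟩
      obtain ⟨b, hb, hbd, hbt⟩ := S.exists_lift_distinctGraph ht
      obtain ⟨r, -, hr⟩ := hbt.exists_scale d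
      rw [val_sub, val_mul, val_mul, hr _ (hd i), hr _ (hd j), ev_line, ev_line]
      by_cases hGt : vals G t = 0
      · rw [show val t (G i) = 0 from congrFun hGt i, show val t (G j) = 0 from congrFun hGt j]
        ring
      · have hinj : Function.Injective (β := ℙ ℂ (Fin 3 → ℂ)) (beta t) := fun i j => hbd.2 i j
        have h2 := hφP t htW hinj
        rw [hφG t htW hGt, isPascal_mk_iff hb hinj] at h2
        have h3 := mul_lineVec_of_dot h2.2.1 h2.2.2 i j
        simp only [vals] at h3
        linear_combination r * (ev (cv b) (L.P L.i) * ev (cv b) (L.Q L.j) -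
          ev (cv b) (L.P L.j) * ev (cv b) (L.Q L.i)) * h3
  · rintro rfl
    exact ⟨{w ∈ X F₁ F₂ | vals L.line w ≠ 0}, isOpenIn_vals_ne_zero _ hd, ⟨hx, h0⟩,
      L.pascalMap e, L.isRegular_pascalMap e fun w hw => hw.2, rfl,
      fun w hw hinj => L.isPascal_pascalMap S e hw.1 hw.2 hinj⟩

theorem vals_line_param (S : Setting F₁ F₂ h a₀) {x : MProj (ext (ext six N₁) N₂)}
    {z : Fin 2 → ℂ} (hx : Lift (snoc (gr F₁ (cv a₀)) (L.param z)) x) :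
    ∃ c : ℂ, c ≠ 0 ∧ vals L.line x = c • pencilParam a₀ z ∧ pencilParam a₀ z ≠ 0 := by
  obtain ⟨d, hd⟩ := L.exists_isForm_line
  obtain ⟨c, hc, h1⟩ := hx.vals_eq hd
  refine ⟨_, mul_ne_zero hc (mul_ne_zero L.ev_U_ne_zero L.minor_ne_zero), ?_, fun h0 => ?_⟩
  · rw [h1, mul_smul]
    congr 1
    funext l
    exact L.ev_line_param z l
  · have hz : z = 0 := pencilParam_injective S (h0.trans (map_zero _).symm)
    exact (hx none).1 (by rw [hz]; exact map_zero L.param)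

theorem vals_line_ne_zero (S : Setting F₁ F₂ h a₀) {x : MProj (ext (ext six N₁) N₂)}
    (hx : x ∈ fibre F₁ F₂ h) : vals L.line x ≠ 0 := by
  obtain ⟨z, hz⟩ := (L.mem_fibre_iff S).1 hx
  obtain ⟨c, hc, h1, h2⟩ := L.vals_line_param S hz
  rw [h1]
  exact smul_ne_zero hc h2

end LocalEquations

end Pascal

/-! ### The proposition -/

open Pascal in
theorem mainTheorem5 {N₁ N₂ : ℕ}
    (F₁ : Fin N₁ → Pascal.Poly Pascal.six)
    (hF₁ : Pascal.Generates F₁ Pascal.Hcirc Pascal.Z)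
    (F₂ : Fin N₂ → Pascal.Poly (Pascal.ext Pascal.six N₁))
    (hF₂ : Pascal.Generates F₂ (Pascal.blowup Pascal.Hcirc F₁) (Pascal.Y' F₁))
    (h : Pascal.MProj Pascal.six) (hh : h ∈ Pascal.sextuples)
    (hθ : (Pascal.theta h).parts =
      {{Pascal.Letter.A, Pascal.Letter.B}, {Pascal.Letter.E, Pascal.Letter.F},
        {Pascal.Letter.C}, {Pascal.Letter.D}})
    (M N P Q : ℙ ℂ (Fin 3 → ℂ))
    (hA : h Pascal.Letter.A = M) (hB : h Pascal.Letter.B = M)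
    (hE : h Pascal.Letter.E = N) (hF : h Pascal.Letter.F = N)
    (hC : h Pascal.Letter.C = P) (hD : h Pascal.Letter.D = Q) :
    (∃ φ : Pascal.MProj Pascal.one → Pascal.MProj (Pascal.ext (Pascal.ext Pascal.six N₁) N₂),
      Pascal.IsIsoOn φ Set.univ (Pascal.fibre F₁ F₂ h)) ∧
    ∃ q : Pascal.MProj (Pascal.ext (Pascal.ext Pascal.six N₁) N₂) → ℙ ℂ (Fin 3 → ℂ),
      (∀ x ∈ Pascal.fibre F₁ F₂ h, ∀ ℓ,
        Pascal.PascalValue F₁ F₂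
          !![Pascal.Letter.A, Pascal.Letter.B, Pascal.Letter.C;
             Pascal.Letter.F, Pascal.Letter.E, Pascal.Letter.D] x ℓ ↔ ℓ = q x) ∧
      Pascal.IsIsoOn (fun x _ => q x) (Pascal.fibre F₁ F₂ h)
        (Pascal.pencil (Projectivization.cross (Projectivization.cross M Q)
          (Projectivization.cross N P))) := by
  obtain ⟨a₀, ha₀, hinj⟩ := exists_rep_eq_cv hh
  have S : Setting F₁ F₂ h a₀ :=
    ⟨hF₁, hF₂, ha₀, fun i j => paired_of_theta hθ, hinj _ _ (hA.trans hB.symm),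
      hinj _ _ (hE.trans hF.symm)⟩
  obtain ⟨L⟩ := S.nonempty_localEquations
  obtain ⟨k, hk⟩ := S.exists_F₁_ne_zero
  obtain ⟨x₁, -, hx₁, -⟩ := S.exists_lift_gr S.lift.ev_sepForm_ne_zero hk
  -- The fibre is a line in the last factor over the single point `x₁` of the first blow-up above
  -- `h`.
  have hfib : ∀ x, x ∈ fibre F₁ F₂ h ↔ base x = x₁ ∧
      ∃ z, ∃ hz : L.param z ≠ 0, last x = Projectivization.mk ℂ _ hz := by
    intro x
    rw [L.mem_fibre_iff S]
    simp only [lift_snoc_iff]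
    constructor
    · rintro ⟨z, h1, h2⟩
      exact ⟨h1.unique hx₁, z, h2⟩
    · rintro ⟨rfl, z, h2⟩
      exact ⟨z, hx₁, h2⟩
  have hlift : ∀ x ∈ fibre F₁ F₂ h, ∀ z (hz : L.param z ≠ 0),
      last x = Projectivization.mk ℂ _ hz → Lift (snoc (gr F₁ (cv a₀)) (L.param z)) x := by
    intro x hx z hz hxz
    obtain ⟨rfl, -⟩ := (hfib x).1 hx
    exact lift_snoc_iff.2 ⟨hx₁, hz, hxz⟩
  have hinjP := L.param_injective
  have he : L.param ![1, 0] ≠ 0 := fun h0 => by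
    have := congrFun (hinjP (h0.trans (map_zero _).symm)) 0
    simp at this
  have hone : (![1, 0] : Fin 2 → ℂ) ≠ 0 := fun h0 => by
    have := congrFun h0 0
    simp at this
  let e := Projectivization.mk ℂ _ he
  constructor
  · obtain ⟨g, hg⟩ := LinearMap.exists_leftInverse_of_injective L.param
      (LinearMap.ker_eq_bot.2 hinjP)
    have hrep : ∀ (x : MProj (ext (ext six N₁) N₂)) z (hz : L.param z ≠ 0),
        last x = Projectivization.mk ℂ _ hz →
        ∃ c : ℂ, c ≠ 0 ∧ g (last x).rep = c • z ∧ z ≠ 0 := by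
      intro x z hz hxz
      obtain ⟨c, hc⟩ := Projectivization.exists_smul_eq_mk_rep ℂ _ hz
      refine ⟨c, c.ne_zero, ?_, fun h0 => hz (by rw [h0, map_zero])⟩
      rw [hxz, ← hc, Units.smul_def, map_smul]
      exact congrArg _ (LinearMap.congr_fun hg z)
    -- The isomorphism is built from the fibre to the projective line, with the identity as second
    -- parametrization, and then inverted.
    refine IsIsoOn.exists_symm (isIsoOn_of_linear (m := 2) e x₁ L.param LinearMap.id hinjP
      Function.injective_id hfib (T := Set.univ) (fun y => ?_)
      (f := fun x => mkOr (Projectivization.mk ℂ _ hone) (g (last x).rep)) ?_ ?_)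
    · simp only [Set.mem_univ, true_iff]
      exact ⟨(y ()).rep, (y ()).rep_nonzero, (Projectivization.mk_rep _).symm⟩
    · refine isRegular_of_linear (n := ext (ext six N₁) N₂) (i := none) g fun x hx => ?_
      obtain ⟨-, z, hz, hxz⟩ := (hfib x).1 hx
      obtain ⟨c, hc, h1, h2⟩ := hrep x z hz hxz
      have h3 : g (last x).rep ≠ 0 := by
        rw [h1]
        exact smul_ne_zero hc h2
      exact ⟨h3, mkOr_of_ne _ h3⟩
    · intro x hx z hz hxz
      obtain ⟨c, hc, h1, h2⟩ := hrep x z hz hxz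
      have h3 : g (last x).rep ≠ 0 := by
        rw [h1]
        exact smul_ne_zero hc h2
      exact ⟨h2, (mkOr_of_ne _ h3).trans (mk_smul_eq _ _ h1)⟩
  · have hne : ∀ {i j}, ¬ Paired i j → h i ≠ h j := fun hij h0 => hij (S.paired _ _ h0)
    obtain ⟨hR, hcross⟩ := S.lift.cross_cross (i := .A) (j := .D) (k := .E) (l := .C)
      (hne (by decide)) (hne (by decide)) (hne (by decide)) (hne (by decide))
    rw [hA, hD, hE, hC] at hcross
    -- The default value `M` is never taken on the fibre, since the forms `line` have no common zero
    -- there.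
    refine ⟨L.pascalMap M, fun x hx ℓ =>
      L.pascalValue_iff S M hx.1 (L.vals_line_ne_zero S hx) ℓ, ?_⟩
    refine isIsoOn_of_linear (m := 3) e x₁ L.param (LocalEquations.pencilParam a₀) hinjP
      (LocalEquations.pencilParam_injective S) hfib (fun y => ?_)
      (L.isRegular_pascalMap M fun x hx => L.vals_line_ne_zero S hx) ?_
    · have hy : y () = Projectivization.mk ℂ _ (y ()).rep_nonzero :=
        (Projectivization.mk_rep _).symm
      rw [pencil, Set.mem_ofPred_eq, hcross, hy, Projectivization.orthogonal_mk]
      constructor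
      · intro h0
        obtain ⟨z, hz⟩ := LocalEquations.exists_pencilParam_eq S hR h0
        exact ⟨z, by rw [hz]; exact (y ()).rep_nonzero, by simp only [hz]⟩
      · rintro ⟨z, hz, hyz⟩
        obtain ⟨c, hc⟩ := (Projectivization.mk_eq_mk_iff' ℂ _ _ _ _).1 hyz
        rw [← hc, smul_dotProduct, LocalEquations.pencilParam_dot S, smul_zero]
    · intro x hx z hz hxz
      obtain ⟨c, hc, h1, h2⟩ := L.vals_line_param S (hlift x hx z hz hxz)
      exact ⟨h2, (mkOr_of_ne M (L.vals_line_ne_zero S hx)).trans (mk_smul_eq _ _ h1)⟩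

end
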